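/- **Model.** There are $T$ rounds and $n$ resources with average amounts $\rho=(\rho^1,\dots,\rho^n)\in(0,1]^n$. In round $t$ a context $\theta_t\sim\mathcal U$ on $\Theta$ is observed, an action $a_t\in\{0,1\}$ is chosen, and an external factor $\gamma_t\sim\mathcal V$ on $\Gamma$ is drawn; all draws are independent. The round yields the reward $r(\theta_t,a_t,\gamma_t)\in[0,1]$ and the consumption $c_t=c(\theta_t,a_t,\gamma_t)\in[0,1]^n$, both zero if $a_t=0$. The factor $\gamma_t$ is then revealed in every round (full feedback) or exactly when $a_t=1$ (partial feedback). Let $R(\theta)=\mathbb E_\gamma[r(\theta,1,\gamma)]$, $C(\theta)=\mathbb E_\gamma[c(\theta,1,\gamma)]$, let $\mathbb E_\theta$ be expectation over an independent $\theta\sim\mathcal U$, and let $$J(\kappa)=\sup\{\mathbb E_\theta[R(\theta)\phi(\theta)] : \phi:\Theta\to[0,1],\ \mathbb E_\theta[C(\theta)\phi(\theta)]\le\kappa\}.$$ **Algorithm.** Put $B_1=\rho T$. In round $t$ let $\rho_t=B_t/(T-t+1)$, and let $\hat\phi_t$ be an optimal solution of the programme obtained from $J(\rho_t)$ by replacing $\mathcal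 U,\mathcal V$ with estimates $\hat{\mathcal U}_t,\hat{\mathcal V}_t$ (finite signed measures) computed from the contexts of rounds $1,\dots,t-1$ and the external factors observed in these rounds. Play $a_t=1$ with probability $\hat\phi_t(\theta_t)$ and put $B_{t+1}=B_t-c_t$. Stop after the first round $t$ with $B_{t+1}^i<1$ for some $i$, and at the latest after round $T$; $T_0$ is the last round played. Let $\mathrm{Rew}=\mathbb E\big[\sum_{t=1}^{T_0}r(\theta_t,a_t,\gamma_t)\big]$. **Notation.** Let $\phi_1^*$ be an optimal solution of $J(\rho)$, let $S=\{i:\mathbb E_\theta[\phi_1^*(\theta)C^i(\theta)]=\rho^i\}$ be the set of binding constraints and let $S^c$ be its complement. For $\delta>0$ let $$\mathcal N=\{\kappa\in\mathbb R_{\ge0}^n : |\kappa^i-\rho^i|\le\delta\ (i\in S),\ \kappa^i-\rho^i\ge-\delta\ (i\in S^c)\}$$ and $T_e=\min\{T_0,\ \min\{t\le T:\rho_t\notin\mathcal N\}-1\}$, where the inner minimum is $T+1$ if there is no such $t$. For $t\le T-1$ and $d\in[0,1]$ let $\mathcal E_t(d)$ be the event that, if $t\le T_0$ and $\rho_t\in\mathcal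 N$, then $$|\rho_t^i-\mathbb E_\theta[\hat\phi_t(\theta)C^i(\theta)]|\le d\ (i\in S),\qquad \rho_t^i-\mathbb E_\theta[\hat\phi_t(\theta)C^i(\theta)]\ge-d\ (i\in S^c).$$ For $\lambda\ge0$ let $$Z(\lambda)=\sup_{\phi:\Theta\to[0,1]}\mathbb E_\theta\big[\phi(\theta)(R(\theta)-\lambda^\top C(\theta))\big]+\lambda^\top\rho .$$ **Theorem.** For every $\delta>0$ there are positive constants $C_1,C_2,C_3$, depending only on $\delta$, such that the following holds for every problem with $\delta<\min_i\rho^i/2$, every $T$, both feedback models and every choice of the estimators and of the optimal solutions above. Assume that 1. $f^C(t,\cdot)$, $1\le t\le T-1$, are functions with $\Pr[\neg\mathcal E_t(d)]\le f^C(t,d)$ for all $d\in[0,1]$; 2. strong duality holds for $J(\rho)$ with optimal dual vector $\lambda^*\ge0$, that is, $Z(\lambda^*)=J(\rho)$; 3. $\mathbb E\Big[\sum_{t=1}^{T_e}\mathbb E_\theta\big[(\phi_1^*(\theta)-\hat\phi_t(\theta))(R(\theta)-(\lambda^*)^\top C(\theta))\big]\Big]\le f^L(T)$. Then $$T\,J(\rho)-\mathrm{Rew}\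 \le\ C_1n\Big(\sum_{t=1}^{T}g(t,\delta/2)+C_2n+C_3\Big)+f^L(T),$$ where $$g(t,\delta/2)=\inf\Big\{\sum_{\tau=1}^{t-1}f^C(\tau,\delta_\tau) : \delta_1,\dots,\delta_{t-1}\in[0,1],\ \sum_{\tau=1}^{t-1}\frac{\delta_\tau}{T-\tau}\le\frac{\delta}{2}\Big\}.$$ -/

import Mathlib

open MeasureTheory

noncomputable section

namespace CBwK

/-- What happens in a round: context, action (`true` is the active action), external factor. -/
abbrev Outcome (Θ Γ : Type*) := Θ × Bool × Γ

/-- The primitive randomness of a round: context, the agent's uniform coin, external factor. -/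
abbrev Draw (Θ Γ : Type*) := Θ × unitInterval × Γ

/-- Full feedback: the external factor is seen in every round.
Partial feedback: it is seen exactly in the rounds with the active action. -/
inductive Feedback
  | fullInfo
  | partialInfo

/-- Is the external factor seen at the end of a round with action `a`? -/
def Feedback.sees : Feedback → Bool → Bool
  | .fullInfo, _ => true
  | .partialInfo, a => a

/-- A binary contextual bandit with `n` knapsack constraints. -/
structure Problem (n : ℕ) (Θ Γ : Type*) [MeasurableSpace Θ] [MeasurableSpace Γ] where
  /-- distribution of the contexts -/
  U : Measure Θ
  /-- distribution of the external factors -/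
  V : Measure Γ
  probU : IsProbabilityMeasure U
  probV : IsProbabilityMeasure V
  /-- reward function -/
  r : Θ → Bool → Γ → ℝ
  /-- consumption function -/
  c : Θ → Bool → Γ → Fin n → ℝ
  /-- average amounts of the resources per round -/
  rho : Fin n → ℝ
  measurable_r : ∀ a, Measurable fun p : Θ × Γ => r p.1 a p.2
  measurable_c : ∀ a i, Measurable fun p : Θ × Γ => c p.1 a p.2 i
  r_mem : ∀ θ a γ, r θ a γ ∈ Set.Icc (0 : ℝ) 1
  c_mem : ∀ θ a γ i, c θ a γ i ∈ Set.Icc (0 : ℝ) 1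
  r_null : ∀ θ γ, r θ false γ = 0
  c_null : ∀ θ γ i, c θ false γ i = 0
  rho_mem : ∀ i, rho i ∈ Set.Ioc (0 : ℝ) 1

attribute [instance] Problem.probU Problem.probV

/-- Measurable maps from contexts to `[0, 1]`: the probability of the active action. -/
def IsControl {Θ : Type*} [MeasurableSpace Θ] (φ : Θ → ℝ) : Prop :=
  Measurable φ ∧ ∀ θ, φ θ ∈ Set.Icc (0 : ℝ) 1

/-- The integral of a real function against a finite signed measure. -/
def signedIntegral {α : Type*} [MeasurableSpace α] (μ : SignedMeasure α) (f : α → ℝ) : ℝ :=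
  VectorMeasure.integral μ f (ContinuousLinearMap.lsmul ℝ ℝ).flip

namespace Problem

variable {n : ℕ} {Θ Γ : Type*} [MeasurableSpace Θ] [MeasurableSpace Γ] (P : Problem n Θ Γ)

/-! ### The fluid problem and its Lagrangian dual -/

/-- `R(θ)`, the expected reward of the active action. -/
def R (θ : Θ) : ℝ := ∫ γ, P.r θ true γ ∂P.V

/-- `C(θ)`, the expected consumption of the active action. -/
def C (θ : Θ) (i : Fin n) : ℝ := ∫ γ, P.c θ true γ i ∂P.V

/-- Expected one-round reward of the control `φ`. -/
def ctrlReward (φ : Θ → ℝ) : ℝ := ∫ θ, P.R θ * φ θ ∂P.U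

/-- Expected one-round consumption of the control `φ`. -/
def ctrlConsumption (φ : Θ → ℝ) (i : Fin n) : ℝ := ∫ θ, P.C θ i * φ θ ∂P.U

/-- Feasible controls of the programme `J(κ)`. -/
def Feasible (κ : Fin n → ℝ) (φ : Θ → ℝ) : Prop :=
  IsControl φ ∧ ∀ i, P.ctrlConsumption φ i ≤ κ i

/-- The optimal value `J(κ)`. -/
def J (κ : Fin n → ℝ) : ℝ := sSup (P.ctrlReward '' {φ | P.Feasible κ φ})

/-- `φ` is an optimal solution of `J(κ)`. -/
def IsOptimal (κ : Fin n → ℝ) (φ : Θ → ℝ) : Prop :=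
  P.Feasible κ φ ∧ ∀ ψ, P.Feasible κ ψ → P.ctrlReward ψ ≤ P.ctrlReward φ

/-- The fluid benchmark `T · J(ρ)`. -/
def fluid (T : ℕ) : ℝ := T * P.J P.rho

/-- The dual function `Z(lam)`: the maximum over randomised actions of the Lagrangian. -/
def Z (lam : Fin n → ℝ) : ℝ :=
  sSup ((fun φ : Θ → ℝ =>
      ∫ θ, ∑ a : Bool, (if a then φ θ else 1 - φ θ) *
        ∫ γ, (P.r θ a γ - ∑ i, lam i * P.c θ a γ i) ∂P.V ∂P.U) '' {φ | IsControl φ})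
    + ∑ i, lam i * P.rho i

/-- Strong duality holds for `J(ρ)`, and `lam` is an optimal dual vector. -/
def StrongDualityAt (lam : Fin n → ℝ) : Prop := (∀ i, 0 ≤ lam i) ∧ P.Z lam = P.J P.rho

/-! ### The estimated programme -/

/-- Expected reward of the active action under the estimate `V'`. -/
def estR (V' : SignedMeasure Γ) (θ : Θ) : ℝ := signedIntegral V' fun γ => P.r θ true γ

/-- Expected consumption of the active action under the estimate `V'`. -/
def estC (V' : SignedMeasure Γ) (θ : Θ) (i : Fin n) : ℝ :=
  signedIntegral V' fun γ => P.c θ true γ i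

/-- Feasible controls of the estimated programme. -/
def EstFeasible (U' : SignedMeasure Θ) (V' : SignedMeasure Γ) (κ : Fin n → ℝ)
    (φ : Θ → ℝ) : Prop :=
  IsControl φ ∧ ∀ i, signedIntegral U' (fun θ => P.estC V' θ i * φ θ) ≤ κ i

/-- Optimal solutions of the estimated programme. -/
def EstOptimal (U' : SignedMeasure Θ) (V' : SignedMeasure Γ) (κ : Fin n → ℝ)
    (φ : Θ → ℝ) : Prop :=
  P.EstFeasible U' V' κ φ ∧ ∀ ψ, P.EstFeasible U' V' κ ψ →
    signedIntegral U' (fun θ => P.estR V' θ * ψ θ)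
      ≤ signedIntegral U' (fun θ => P.estR V' θ * φ θ)

/-! ### Histories, with `t` the number of completed rounds and `T` the horizon -/

/-- The remaining budget `B_{t+1} = ρ T - c_1 - ⋯ - c_t`. -/
def budget (T : ℕ) {t : ℕ} (h : Fin t → Outcome Θ Γ) (i : Fin n) : ℝ :=
  P.rho i * T - ∑ s, P.c (h s).1 (h s).2.1 (h s).2.2 i

/-- The remaining average budget `ρ_{t+1} = B_{t+1} / (T - t)`. -/
def avgBudget (T : ℕ) {t : ℕ} (h : Fin t → Outcome Θ Γ) (i : Fin n) : ℝ :=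
  P.budget T h i / ((T : ℝ) - t)

/-- The algorithm has not stopped after the rounds of `h`: after each of them, every resource
had at least one unit left. -/
def Running (T : ℕ) {t : ℕ} (h : Fin t → Outcome Θ Γ) : Prop :=
  ∀ s : ℕ, 1 ≤ s → ∀ hs : s ≤ t, ∀ i,
    1 ≤ P.budget T (fun j : Fin s => h (Fin.castLE hs j)) i

end Problem

/-- The contexts of a history, in order. -/
def contexts {Θ Γ : Type*} {t : ℕ} (h : Fin t → Outcome Θ Γ) : List Θ :=
  List.ofFn fun s => (h s).1

/-- The observed external factors of a history, in order. -/
def samples {Θ Γ : Type*} (fb : Feedback) {t : ℕ} (h : Fin t → Outcome Θ Γ) : List Γ :=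
  ((List.ofFn h).filter fun x => fb.sees x.2.1).map fun x => x.2.2

/-- Two histories that the agent cannot tell apart. -/
def SameObservations {Θ Γ : Type*} (fb : Feedback) {t : ℕ} (h h' : Fin t → Outcome Θ Γ) : Prop :=
  ∀ s, (h s).1 = (h' s).1 ∧ (h s).2.1 = (h' s).2.1 ∧
    (fb.sees (h s).2.1 = true → (h s).2.2 = (h' s).2.2)

/-- The re-solving algorithm with horizon `T` under the feedback model `fb`. It is specified by
two estimators, which turn a finite sample into an estimate of the distribution it comes from,
and by the selection `phiHat` of an optimal solution of the estimated programme. The estimates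
may be signed measures, as those given by a kernel density estimator are.
`phiHat t h` is the control used in round `t + 1` after the history `h` of the first `t` rounds. -/
structure ReSolving {n : ℕ} {Θ Γ : Type*} [MeasurableSpace Θ] [MeasurableSpace Γ]
    (P : Problem n Θ Γ) (T : ℕ) (fb : Feedback) where
  estU : List Θ → SignedMeasure Θ
  estV : List Γ → SignedMeasure Γ
  phiHat : (t : ℕ) → (Fin t → Outcome Θ Γ) → Θ → ℝ
  measurable_phiHat : ∀ t,
    Measurable fun p : (Fin t → Outcome Θ Γ) × Θ => phiHat t p.1 p.2
  nonanticipating : ∀ t (h h' : Fin t → Outcome Θ Γ),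
    SameObservations fb h h' → phiHat t h = phiHat t h'
  optimal : ∀ t, t < T → ∀ h : Fin t → Outcome Θ Γ, P.Running T h →
    P.EstOptimal (estU (contexts h)) (estV (samples fb h)) (P.avgBudget T h) (phiHat t h)

/-- The outcome of a round with control `φ`: the active action is taken iff the uniform coin
falls below `φ θ`, hence with probability `φ θ`. -/
def play {Θ Γ : Type*} (φ : Θ → ℝ) (x : Draw Θ Γ) : Outcome Θ Γ :=
  (x.1, decide ((x.2.1 : ℝ) < φ x.1), x.2.2)

namespace ReSolving

variable {n : ℕ} {Θ Γ : Type*} [MeasurableSpace Θ] [MeasurableSpace Γ] {P : Problem n Θ Γ}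
  {T : ℕ} {fb : Feedback} (A : ReSolving P T fb)

/-- The law of the i.i.d. draws; round `t ≥ 1` uses the draw with index `t`. -/
def law (_A : ReSolving P T fb) : Measure (ℕ → Draw Θ Γ) :=
  Measure.infinitePi fun _ : ℕ => P.U.prod ((volume : Measure unitInterval).prod P.V)

/-- The history of the first `t` rounds. (It is continued formally after the stopping time;
nothing below depends on that continuation.) -/
def hist : (t : ℕ) → (ℕ → Draw Θ Γ) → Fin t → Outcome Θ Γ
  | 0, _ => Fin.elim0
  | t + 1, ω =>
      Fin.snoc (α := fun _ => Outcome Θ Γ) (hist t ω) (play (A.phiHat t (hist t ω)) (ω (t + 1)))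

/-- The control of round `t ≥ 1`. -/
def control (t : ℕ) (ω : ℕ → Draw Θ Γ) : Θ → ℝ := A.phiHat (t - 1) (A.hist (t - 1) ω)

/-- The outcome of round `t ≥ 1`. -/
def outcome (t : ℕ) (ω : ℕ → Draw Θ Γ) : Outcome Θ Γ := play (A.control t ω) (ω t)

/-- The reward of round `t ≥ 1`. -/
def reward (t : ℕ) (ω : ℕ → Draw Θ Γ) : ℝ :=
  P.r (A.outcome t ω).1 (A.outcome t ω).2.1 (A.outcome t ω).2.2

/-- The budget `B_t` at the start of round `t ≥ 1`. -/
def B (t : ℕ) (ω : ℕ → Draw Θ Γ) : Fin n → ℝ := P.budget T (A.hist (t - 1) ω)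

/-- The average budget `ρ_t = B_t / (T - t + 1)` at the start of round `t ≥ 1`. -/
def rhoAt (t : ℕ) (ω : ℕ → Draw Θ Γ) : Fin n → ℝ := P.avgBudget T (A.hist (t - 1) ω)

/-- The stopping time `T₀`, the last executed round: the first round after which some resource
has less than one unit left, and `T` if there is none before. -/
def T0 (ω : ℕ → Draw Θ Γ) : ℕ :=
  sInf ({t | 1 ≤ t ∧ ∃ i, A.B (t + 1) ω i < 1} ∪ {T})

/-- The expected accumulated reward. -/
def rew : ℝ := ∫ ω, ∑ t ∈ Finset.Icc 1 (A.T0 ω), A.reward t ω ∂A.law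

end ReSolving

section Local

variable {n : ℕ} {Θ Γ : Type*} [MeasurableSpace Θ] [MeasurableSpace Γ]

/-- The binding constraints of `J(ρ)` at the optimal solution `φ₁`. -/
def Problem.binding (P : Problem n Θ Γ) (φ₁ : Θ → ℝ) : Set (Fin n) :=
  {i | P.ctrlConsumption φ₁ i = P.rho i}

/-- The neighbourhood `N(ρ, δ, S)`: coordinates in `S` within `δ` of `ρ`, the others at least
`ρ - δ`. -/
def nbhd (rho : Fin n → ℝ) (δ : ℝ) (S : Set (Fin n)) : Set (Fin n → ℝ) :=
  {κ | (∀ i, 0 ≤ κ i) ∧ (∀ i ∈ S, |κ i - rho i| ≤ δ) ∧ ∀ i ∉ S, -δ ≤ κ i - rho i}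

namespace ReSolving

variable {P : Problem n Θ Γ} {T : ℕ} {fb : Feedback} (A : ReSolving P T fb)

/-- `T_e = min {T₀, min {t : ρ_t ∉ N(ρ, δ, S)} - 1}`, where the inner minimum ranges over the
rounds `1, …, T` and is read as `T + 1` if there is no such round. -/
def Te (δ : ℝ) (φ₁ : Θ → ℝ) (ω : ℕ → Draw Θ Γ) : ℕ :=
  min (A.T0 ω)
    (sInf ({t | 1 ≤ t ∧ A.rhoAt t ω ∉ nbhd P.rho δ (P.binding φ₁)} ∪ {T + 1}) - 1)

/-- The accuracy event of round `t` at level `d`: if round `t` takes place and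
`ρ_t ∈ N(ρ, δ, S)`, then the expected consumption of the control of round `t` differs from
`ρ_t` by at most `d` on binding constraints and exceeds `ρ_t` by at most `d` on the others. -/
def accurate (δ : ℝ) (φ₁ : Θ → ℝ) (t : ℕ) (d : ℝ) : Set (ℕ → Draw Θ Γ) :=
  {ω | t ≤ A.T0 ω → A.rhoAt t ω ∈ nbhd P.rho δ (P.binding φ₁) →
    (∀ i ∈ P.binding φ₁, |A.rhoAt t ω i - P.ctrlConsumption (A.control t ω) i| ≤ d) ∧
    ∀ i ∉ P.binding φ₁, -d ≤ A.rhoAt t ω i - P.ctrlConsumption (A.control t ω) i}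

/-- The Lagrangian estimation error of round `t`. -/
def lagrangianError (φ₁ : Θ → ℝ) (lam : Fin n → ℝ) (t : ℕ) (ω : ℕ → Draw Θ Γ) : ℝ :=
  ∫ θ, (φ₁ θ - A.control t ω θ) * (P.R θ - ∑ i, lam i * P.C θ i) ∂P.U

end ReSolving

/-- The least sum of failure probabilities `∑_{τ < t} f(τ, d_τ)` over levels `d_τ ∈ [0, 1]`
with `∑_{τ < t} d_τ / (T - τ) ≤ b`. -/
def gC (T : ℕ) (f : ℕ → ℝ → ℝ) (t : ℕ) (b : ℝ) : ℝ :=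
  sInf ((fun d : ℕ → ℝ => ∑ τ ∈ Finset.Ico 1 t, f τ (d τ)) ''
    {d | (∀ τ ∈ Finset.Ico 1 t, d τ ∈ Set.Icc (0 : ℝ) 1) ∧
      ∑ τ ∈ Finset.Ico 1 t, d τ / ((T : ℝ) - τ) ≤ b})

end Local

end CBwK

end

open MeasureTheory

noncomputable section

namespace CBwK

/-! ### Randomised actions and resampling of one round -/

section Generic

variable {Θ Γ : Type*} [MeasurableSpace Θ] [MeasurableSpace Γ]

/-! Up to `Te` the algorithm is compared with the Lagrangian optimum. Charge a round the loss `J(ρ)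
- λ·ρ - (r - λ·c)`. Summed over the first `N = Te` rounds, losses plus rewards telescope through the
budget, and `T J(ρ)` exceeds this sum by exactly `(T - N) J(ρ) + ∑ i, λ i * (B_{N+1} i - ρ i * (T -
N))`. Complementary slackness removes the non-binding resources. For a binding one, `ρ_N ≤ ρ + δ`
bounds the leftover budget by `δ (T - N) + 2`, while `λ i * δ ≤ 1/2` because `λ·ρ ≤ 1`. So at most
`n (3/2 (T - N) + 1/δ)` is lost (`fluid_le_sum_roundLoss`). Whether `t ≤ Te` is decided before round
`t`, so the expected losses are the Lagrangian errors (`integral_sum_lagrangianError`). This leaves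
the expectation of `T - Te`, that is, the sum over `t` of the probabilities of `Te < t`.

The average budget satisfies `ρ_{t+1} = ρ_t + (ρ_t - c_t)/(T - t)`. Inserting the conditional mean
of `c_t` splits each increment into drift and centred noise. If the controls are accurate at levels
`d τ` with `∑ d τ / (T - τ) ≤ δ/2`, the drift moves a binding coordinate by at most `δ/2` and lowers
any other by at most `δ/2`. Leaving the neighbourhood then needs noise of size `δ/2`
(`exists_noiseSum_ge`). The noise is frozen at the exit, so its value at the single time `t` records
an exit at any earlier time and no maximal inequality is needed. Its squared ranges sum to at most
`1/(T - t)`, so Azuma–Hoeffding gives `2 exp(-δ²(T - t)/2)` per resource (`measure_noiseSum_ge_le`).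
The failures of accuracy contribute `gC`, and the exponentials sum to a constant independent of `T`.

Conditional expectations never appear: conditioning on the past is replaced by redrawing the
randomness of one round. -/

theorem measurable_outcome_apply {f : Θ → Bool → Γ → ℝ}
    (hf : ∀ a, Measurable fun p : Θ × Γ => f p.1 a p.2) :
    Measurable fun x : Outcome Θ Γ => f x.1 x.2.1 x.2.2 := by
  have h : (fun x : Outcome Θ Γ => f x.1 x.2.1 x.2.2) =
      fun x => if x.2.1 = true then f x.1 true x.2.2 else f x.1 false x.2.2 := by
    funext x
    rcases x with ⟨θ, _ | _, γ⟩ <;> simp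
  rw [h]
  refine Measurable.ite ?_ ?_ ?_
  · exact measurableSet_eq_fun (by fun_prop) measurable_const
  · exact (hf true).comp (by fun_prop : Measurable fun x : Outcome Θ Γ => (x.1, x.2.2))
  · exact (hf false).comp (by fun_prop : Measurable fun x : Outcome Θ Γ => (x.1, x.2.2))

theorem measurable_play {α : Type*} [MeasurableSpace α] {φ : α → Θ → ℝ}
    (hφ : Measurable fun p : α × Θ => φ p.1 p.2) {x : α → Draw Θ Γ} (hx : Measurable x) :
    Measurable fun a => play (φ a) (x a) := by
  unfold play
  have h : Measurable fun a => φ a (x a).1 :=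
    hφ.comp (measurable_id.prodMk (measurable_fst.comp hx))
  have hu : Measurable fun a => (((x a).2.1 : unitInterval) : ℝ) :=
    measurable_subtype_coe.comp (by fun_prop)
  have hd : Measurable fun a => decide (((x a).2.1 : ℝ) < φ a (x a).1) := by
    refine measurable_to_bool ?_
    have : (fun a => decide (((x a).2.1 : ℝ) < φ a (x a).1)) ⁻¹' {true} =
        {a | ((x a).2.1 : ℝ) < φ a (x a).1} := by
      ext a; simp
    rw [this]
    exact measurableSet_lt hu h
  fun_prop

theorem integral_unitInterval_lt {a : ℝ} (ha : a ∈ Set.Icc (0 : ℝ) 1) :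
    ∫ u : unitInterval, (if (u : ℝ) < a then (1 : ℝ) else 0) = a := by
  have h : (fun u : unitInterval => if (u : ℝ) < a then (1 : ℝ) else 0) =
      (Set.Iio (⟨a, ha⟩ : unitInterval)).indicator 1 := by
    funext u
    simp only [Set.indicator_apply, Set.mem_Iio, Pi.one_apply]
    rfl
  rw [h, integral_indicator_one measurableSet_Iio, measureReal_def, unitInterval.volume_Iio,
    ENNReal.toReal_ofReal ha.1]

/-- The law of `play φ` integrates to the mean of the active action weighted by `φ`. -/
theorem integral_play (U : Measure Θ) (V : Measure Γ) [IsProbabilityMeasure U]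
    [IsProbabilityMeasure V] {f : Θ → Bool → Γ → ℝ}
    (hf : ∀ a, Measurable fun p : Θ × Γ => f p.1 a p.2)
    (hf1 : ∀ θ a γ, f θ a γ ∈ Set.Icc (0 : ℝ) 1) (hf0 : ∀ θ γ, f θ false γ = 0)
    {φ : Θ → ℝ} (hφ : IsControl φ) :
    ∫ x, f (play φ x).1 (play φ x).2.1 (play φ x).2.2
      ∂(U.prod ((volume : Measure unitInterval).prod V)) =
    ∫ θ, (∫ γ, f θ true γ ∂V) * φ θ ∂U := by
  rw [integral_prod]
  · refine integral_congr_ae (Filter.Eventually.of_forall fun θ => ?_)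
    have h : (fun y : unitInterval × Γ =>
        f (play φ (θ, y)).1 (play φ (θ, y)).2.1 (play φ (θ, y)).2.2) =
        fun y => (if (y.1 : ℝ) < φ θ then (1 : ℝ) else 0) * f θ true y.2 := by
      funext y
      simp only [play]
      by_cases hy : (y.1 : ℝ) < φ θ <;> simp [hy, hf0]
    simp only [h]
    rw [integral_prod_mul (fun u : unitInterval => if (u : ℝ) < φ θ then (1 : ℝ) else 0)
      (fun γ => f θ true γ), integral_unitInterval_lt (hφ.2 θ), mul_comm]
  · refine Integrable.of_mem_Icc 0 1 ?_ (Filter.Eventually.of_forall fun x => hf1 _ _ _)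
    refine ((measurable_outcome_apply hf).comp
      (measurable_play (φ := fun _ : Draw Θ Γ => φ) ?_ measurable_id)).aemeasurable
    exact hφ.1.comp measurable_snd

/-- Resampling one coordinate leaves an infinite product of copies of `ν` invariant. -/
theorem map_update_infinitePi {X : Type*} [MeasurableSpace X] (ν : Measure X)
    [IsProbabilityMeasure ν] (k : ℕ) :
    ((Measure.infinitePi fun _ : ℕ => ν).prod ν).map
      (fun p : (ℕ → X) × X => Function.update p.1 k p.2) = Measure.infinitePi fun _ : ℕ => ν := by
  have hm : Measurable fun p : (ℕ → X) × X => Function.update p.1 k p.2 := by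
    refine measurable_pi_iff.2 fun j => ?_
    by_cases hj : j = k
    · subst hj; simpa using measurable_snd
    · simp only [Function.update_of_ne hj]
      exact (measurable_pi_apply j).comp measurable_fst
  refine Measure.eq_infinitePi (μ := fun _ : ℕ => ν) fun s t ht => ?_
  rw [Measure.map_apply hm (MeasurableSet.pi s.countable_toSet fun i _ => ht i)]
  -- On a box that restricts coordinate `k`, the fresh draw supplies the factor of `k` and the old
  -- one is left free; on any other box the fresh draw is free and has mass one.
  by_cases hk : k ∈ s
  · have h : (fun p : (ℕ → X) × X => Function.update p.1 k p.2) ⁻¹' (Set.pi (s : Set ℕ) t) =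
        (Set.pi ((s.erase k : Finset ℕ) : Set ℕ) t) ×ˢ (t k) := by
      ext p
      simp only [Set.mem_preimage, Set.mem_pi, Finset.mem_coe, Set.mem_prod, Finset.mem_erase]
      constructor
      · intro h
        refine ⟨fun i hi => ?_, ?_⟩
        · simpa [Function.update_of_ne hi.1] using h i hi.2
        · simpa using h k hk
      · rintro ⟨h1, h2⟩ i hi
        by_cases hik : i = k
        · subst hik; simpa using h2
        · simpa [Function.update_of_ne hik] using h1 i ⟨hik, hi⟩
    rw [h, Measure.prod_prod, Measure.infinitePi_pi _ (fun i _ => ht i),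
      Finset.prod_erase_mul s (fun i => ν (t i)) hk]
  · have h : (fun p : (ℕ → X) × X => Function.update p.1 k p.2) ⁻¹' (Set.pi (s : Set ℕ) t) =
        (Set.pi (s : Set ℕ) t) ×ˢ Set.univ := by
      ext p
      simp only [Set.mem_preimage, Set.mem_pi, Finset.mem_coe, Set.mem_prod, Set.mem_univ,
        and_true]
      refine forall₂_congr fun i hi => ?_
      have : i ≠ k := fun e => hk (e ▸ hi)
      simp [Function.update_of_ne this]
    rw [h, Measure.prod_prod, Measure.infinitePi_pi _ (fun i _ => ht i), measure_univ, mul_one]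

end Generic

/-! ### One-round means, Lagrangian duality and complementary slackness -/

namespace Problem

variable {n : ℕ} {Θ Γ : Type*} [MeasurableSpace Θ] [MeasurableSpace Γ] (P : Problem n Θ Γ)

/-- The law of the randomness of one round. -/
def drawLaw : Measure (Draw Θ Γ) := P.U.prod ((volume : Measure unitInterval).prod P.V)

instance : IsProbabilityMeasure P.drawLaw := by unfold drawLaw; infer_instance

theorem measurable_R : Measurable P.R :=
  (P.measurable_r true).stronglyMeasurable.integral_prod_right'.measurable

theorem measurable_C (i : Fin n) : Measurable fun θ => P.C θ i :=
  (P.measurable_c true i).stronglyMeasurable.integral_prod_right'.measurable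

theorem integral_mem_Icc {α : Type*} [MeasurableSpace α] (μ : Measure α) [IsProbabilityMeasure μ]
    {f : α → ℝ} (hm : Measurable f) (hf : ∀ x, f x ∈ Set.Icc (0 : ℝ) 1) :
    ∫ x, f x ∂μ ∈ Set.Icc (0 : ℝ) 1 := by
  refine ⟨integral_nonneg fun x => (hf x).1, ?_⟩
  have := integral_mono (Integrable.of_mem_Icc 0 1 hm.aemeasurable
    (Filter.Eventually.of_forall hf)) (integrable_const (μ := μ) (1 : ℝ)) fun x => (hf x).2
  simpa using this

theorem R_mem (θ : Θ) : P.R θ ∈ Set.Icc (0 : ℝ) 1 :=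
  integral_mem_Icc _ ((P.measurable_r true).comp measurable_prodMk_left) fun _ => P.r_mem _ _ _

theorem C_mem (θ : Θ) (i : Fin n) : P.C θ i ∈ Set.Icc (0 : ℝ) 1 :=
  integral_mem_Icc _ ((P.measurable_c true i).comp measurable_prodMk_left)
    fun _ => P.c_mem _ _ _ _

theorem mul_mem_Icc {a b : ℝ} (ha : a ∈ Set.Icc (0 : ℝ) 1) (hb : b ∈ Set.Icc (0 : ℝ) 1) :
    a * b ∈ Set.Icc (0 : ℝ) 1 :=
  ⟨mul_nonneg ha.1 hb.1, mul_le_one₀ ha.2 hb.1 hb.2⟩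

theorem integrable_R_mul {φ : Θ → ℝ} (hφ : IsControl φ) :
    Integrable (fun θ => P.R θ * φ θ) P.U :=
  Integrable.of_mem_Icc 0 1 (P.measurable_R.mul hφ.1).aemeasurable
    (Filter.Eventually.of_forall fun θ => mul_mem_Icc (P.R_mem θ) (hφ.2 θ))

theorem integrable_C_mul {φ : Θ → ℝ} (hφ : IsControl φ) (i : Fin n) :
    Integrable (fun θ => P.C θ i * φ θ) P.U :=
  Integrable.of_mem_Icc 0 1 ((P.measurable_C i).mul hφ.1).aemeasurable
    (Filter.Eventually.of_forall fun θ => mul_mem_Icc (P.C_mem θ i) (hφ.2 θ))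

theorem ctrlReward_mem {φ : Θ → ℝ} (hφ : IsControl φ) :
    P.ctrlReward φ ∈ Set.Icc (0 : ℝ) 1 :=
  integral_mem_Icc _ (P.measurable_R.mul hφ.1) fun θ => mul_mem_Icc (P.R_mem θ) (hφ.2 θ)

theorem ctrlConsumption_mem {φ : Θ → ℝ} (hφ : IsControl φ) (i : Fin n) :
    P.ctrlConsumption φ i ∈ Set.Icc (0 : ℝ) 1 :=
  integral_mem_Icc _ ((P.measurable_C i).mul hφ.1) fun θ => mul_mem_Icc (P.C_mem θ i) (hφ.2 θ)

theorem integral_reward_play {φ : Θ → ℝ} (hφ : IsControl φ) :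
    ∫ x, P.r (play φ x).1 (play φ x).2.1 (play φ x).2.2 ∂P.drawLaw = P.ctrlReward φ :=
  integral_play P.U P.V P.measurable_r P.r_mem P.r_null hφ

theorem integral_consumption_play {φ : Θ → ℝ} (hφ : IsControl φ) (i : Fin n) :
    ∫ x, P.c (play φ x).1 (play φ x).2.1 (play φ x).2.2 i ∂P.drawLaw = P.ctrlConsumption φ i :=
  integral_play P.U P.V (f := fun θ a γ => P.c θ a γ i) (fun a => P.measurable_c a i)
    (fun _ _ _ => P.c_mem _ _ _ _) (fun _ _ => P.c_null _ _ _) hφ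

/-! ### Duality -/

theorem integral_mul_lagrangian {φ : Θ → ℝ} (hφ : IsControl φ) (lam : Fin n → ℝ) :
    Integrable (fun θ => φ θ * (P.R θ - ∑ i, lam i * P.C θ i)) P.U ∧
    ∫ θ, φ θ * (P.R θ - ∑ i, lam i * P.C θ i) ∂P.U =
      P.ctrlReward φ - ∑ i, lam i * P.ctrlConsumption φ i := by
  have h : (fun θ => φ θ * (P.R θ - ∑ i, lam i * P.C θ i)) =
      fun θ => P.R θ * φ θ - ∑ i, lam i * (P.C θ i * φ θ) := by
    funext θ
    rw [mul_sub, Finset.mul_sum, mul_comm]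
    congr 1
    exact Finset.sum_congr rfl fun i _ => by ring
  have hs : Integrable (fun θ => ∑ i, lam i * (P.C θ i * φ θ)) P.U :=
    integrable_finsetSum _ fun i _ => (P.integrable_C_mul hφ i).const_mul _
  rw [h]
  refine ⟨(P.integrable_R_mul hφ).sub hs, ?_⟩
  rw [integral_sub (P.integrable_R_mul hφ) hs,
    integral_finsetSum _ fun i _ => (P.integrable_C_mul hφ i).const_mul _]
  simp only [integral_const_mul]
  rfl

/-- The null action earns and consumes nothing, so the sum over actions inside `Z` collapses to its
active term. -/
theorem lagrangian_round {φ : Θ → ℝ} (lam : Fin n → ℝ) (θ : Θ) :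
    ∑ a : Bool, (if a then φ θ else 1 - φ θ) *
        ∫ γ, (P.r θ a γ - ∑ i, lam i * P.c θ a γ i) ∂P.V =
      φ θ * (P.R θ - ∑ i, lam i * P.C θ i) := by
  have hr : Integrable (fun γ => P.r θ true γ) P.V :=
    Integrable.of_mem_Icc 0 1 ((P.measurable_r true).comp measurable_prodMk_left).aemeasurable
      (Filter.Eventually.of_forall fun _ => P.r_mem _ _ _)
  have hc (i : Fin n) : Integrable (fun γ => lam i * P.c θ true γ i) P.V :=
    (Integrable.of_mem_Icc 0 1 ((P.measurable_c true i).comp measurable_prodMk_left).aemeasurable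
      (Filter.Eventually.of_forall fun _ => P.c_mem _ _ _ _)).const_mul _
  simp only [Fintype.sum_bool, if_true, P.r_null, P.c_null, mul_zero, Finset.sum_const_zero,
    sub_zero, integral_zero, add_zero]
  rw [integral_sub hr (integrable_finsetSum _ fun i _ => hc i),
    integral_finsetSum _ fun i _ => hc i]
  simp only [integral_const_mul]
  rfl

variable {P}

theorem IsOptimal.J_eq {κ : Fin n → ℝ} {φ : Θ → ℝ} (h : P.IsOptimal κ φ) :
    P.J κ = P.ctrlReward φ :=
  IsGreatest.csSup_eq ⟨⟨φ, h.1, rfl⟩, by rintro _ ⟨ψ, hψ, rfl⟩; exact h.2 ψ hψ⟩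

theorem StrongDualityAt.lagrangian_le {lam : Fin n → ℝ} (h : P.StrongDualityAt lam)
    {φ : Θ → ℝ} (hφ : IsControl φ) :
    P.ctrlReward φ - ∑ i, lam i * P.ctrlConsumption φ i ≤
      P.J P.rho - ∑ i, lam i * P.rho i := by
  rw [← h.2, Z, add_sub_cancel_right, ← (P.integral_mul_lagrangian hφ lam).2]
  simp only [lagrangian_round]
  -- The real supremum is informative only if bounded: rewards are at most one and the priced
  -- consumption is nonnegative.
  refine le_csSup ⟨1, ?_⟩ ⟨φ, hφ, rfl⟩
  rintro _ ⟨ψ, hψ, rfl⟩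
  dsimp only
  rw [(P.integral_mul_lagrangian hψ lam).2]
  have := (P.ctrlReward_mem hψ).2
  have : 0 ≤ ∑ i, lam i * P.ctrlConsumption ψ i :=
    Finset.sum_nonneg fun i _ => mul_nonneg (h.1 i) (P.ctrlConsumption_mem hψ i).1
  linarith

/-- Testing the Lagrangian bound with `φ` itself gives `λ·ρ ≤ λ·C(φ)`, while feasibility gives the
reverse inequality term by term; hence every term is an equality. -/
theorem StrongDualityAt.complementary {lam : Fin n → ℝ} (h : P.StrongDualityAt lam)
    {φ : Θ → ℝ} (hφ : P.IsOptimal P.rho φ) (i : Fin n) :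
    lam i * P.ctrlConsumption φ i = lam i * P.rho i := by
  have h1 := h.lagrangian_le hφ.1.1
  rw [hφ.J_eq] at h1
  have h2 : ∀ j ∈ Finset.univ, lam j * P.ctrlConsumption φ j ≤ lam j * P.rho j :=
    fun j _ => mul_le_mul_of_nonneg_left (hφ.1.2 j) (h.1 j)
  have h3 := (Finset.sum_eq_sum_iff_of_le h2).1
    (le_antisymm (Finset.sum_le_sum h2) (by linarith))
  exact h3 i (Finset.mem_univ i)

theorem StrongDualityAt.eq_zero_of_not_binding {lam : Fin n → ℝ} (h : P.StrongDualityAt lam)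
    {φ : Θ → ℝ} (hφ : P.IsOptimal P.rho φ) {i : Fin n} (hi : i ∉ P.binding φ) : lam i = 0 := by
  by_contra h0
  exact hi (mul_left_cancel₀ h0 (h.complementary hφ i))

theorem IsOptimal.J_mem {κ : Fin n → ℝ} {φ : Θ → ℝ} (h : P.IsOptimal κ φ) :
    P.J κ ∈ Set.Icc (0 : ℝ) 1 := by
  rw [h.J_eq]; exact P.ctrlReward_mem h.1.1

/-- The control that never acts has Lagrangian value zero, so `λ·ρ ≤ J(ρ) ≤ 1`. This is what bounds
the dual prices in terms of `δ`. -/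
theorem StrongDualityAt.lam_mul_rho_le {lam : Fin n → ℝ} (h : P.StrongDualityAt lam)
    {φ : Θ → ℝ} (hφ : P.IsOptimal P.rho φ) (i : Fin n) : lam i * P.rho i ≤ 1 := by
  have h0 : IsControl (fun _ : Θ => (0 : ℝ)) := ⟨measurable_const, fun _ => by simp⟩
  have h1 := h.lagrangian_le h0
  have h2 := (P.ctrlReward_mem h0).1
  have h3 : ∑ i, lam i * P.ctrlConsumption (fun _ => 0) i = 0 := by
    simp [ctrlConsumption]
  have h4 := hφ.J_mem.2
  have h5 : lam i * P.rho i ≤ ∑ j, lam j * P.rho j :=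
    Finset.single_le_sum (f := fun j => lam j * P.rho j)
      (fun j _ => mul_nonneg (h.1 j) (P.rho_mem j).1.le) (Finset.mem_univ i)
  linarith

end Problem

end CBwK

/-! ### The budget process: measurability, resampling and stopping times -/

namespace CBwK

namespace ReSolving

variable {n : ℕ} {Θ Γ : Type*} [MeasurableSpace Θ] [MeasurableSpace Γ] {P : Problem n Θ Γ}
  {T : ℕ} {fb : Feedback} (A : ReSolving P T fb)

instance : IsProbabilityMeasure A.law :=
  inferInstanceAs (IsProbabilityMeasure (Measure.infinitePi fun _ : ℕ => P.drawLaw))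

/-- The consumption of round `t ≥ 1`. -/
def consumption (t : ℕ) (ω : ℕ → Draw Θ Γ) (i : Fin n) : ℝ :=
  P.c (A.outcome t ω).1 (A.outcome t ω).2.1 (A.outcome t ω).2.2 i

/-- The expected consumption of round `t ≥ 1` given the previous rounds. -/
def meanConsumption (t : ℕ) (ω : ℕ → Draw Θ Γ) (i : Fin n) : ℝ :=
  ∫ x, P.c (play (A.control t ω) x).1 (play (A.control t ω) x).2.1 (play (A.control t ω) x).2.2 i
    ∂P.drawLaw

/-! ### Measurability -/

theorem measurable_hist (t : ℕ) : Measurable (A.hist t) := by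
  induction t with
  | zero => exact measurable_pi_iff.2 fun j => j.elim0
  | succ t ih =>
    refine measurable_pi_iff.2 fun j => ?_
    refine Fin.lastCases ?_ (fun j => ?_) j
    · simp only [hist, Fin.snoc_last]
      refine measurable_play (φ := fun ω => A.phiHat t (A.hist t ω)) ?_ (measurable_pi_apply _)
      exact (A.measurable_phiHat t).comp
        ((ih.comp measurable_fst).prodMk measurable_snd)
    · simp only [hist, Fin.snoc_castSucc]
      exact (measurable_pi_apply j).comp ih

theorem measurable_control (t : ℕ) :
    Measurable fun p : (ℕ → Draw Θ Γ) × Θ => A.control t p.1 p.2 :=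
  (A.measurable_phiHat (t - 1)).comp
    (((A.measurable_hist (t - 1)).comp measurable_fst).prodMk measurable_snd)

theorem measurable_play_control (t : ℕ) :
    Measurable fun p : (ℕ → Draw Θ Γ) × Draw Θ Γ => play (A.control t p.1) p.2 :=
  measurable_play (φ := fun p : (ℕ → Draw Θ Γ) × Draw Θ Γ => A.control t p.1)
    ((A.measurable_control t).comp
      ((measurable_fst.comp measurable_fst).prodMk measurable_snd)) measurable_snd

theorem measurable_outcome (t : ℕ) : Measurable (A.outcome t) :=
  (A.measurable_play_control t).comp (measurable_id.prodMk (measurable_pi_apply t))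

theorem measurable_reward (t : ℕ) : Measurable (A.reward t) :=
  (measurable_outcome_apply P.measurable_r).comp (A.measurable_outcome t)

theorem measurable_consumption_apply (i : Fin n) :
    Measurable fun x : Outcome Θ Γ => P.c x.1 x.2.1 x.2.2 i :=
  measurable_outcome_apply (f := fun θ a γ => P.c θ a γ i) fun a => P.measurable_c a i

theorem measurable_consumption (t : ℕ) (i : Fin n) :
    Measurable fun ω => A.consumption t ω i :=
  (measurable_consumption_apply i).comp (A.measurable_outcome t)

theorem measurable_meanConsumption (t : ℕ) (i : Fin n) :
    Measurable fun ω => A.meanConsumption t ω i :=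
  ((measurable_consumption_apply (P := P) i).comp
    (A.measurable_play_control t)).stronglyMeasurable.integral_prod_right'.measurable

theorem consumption_mem (t : ℕ) (ω : ℕ → Draw Θ Γ) (i : Fin n) :
    A.consumption t ω i ∈ Set.Icc (0 : ℝ) 1 := P.c_mem _ _ _ _

theorem meanConsumption_mem (t : ℕ) (ω : ℕ → Draw Θ Γ) (i : Fin n) :
    A.meanConsumption t ω i ∈ Set.Icc (0 : ℝ) 1 :=
  Problem.integral_mem_Icc _ ((measurable_consumption_apply (P := P) i).comp
    ((A.measurable_play_control t).comp measurable_prodMk_left)) fun _ => P.c_mem _ _ _ _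

theorem measurable_B (t : ℕ) (i : Fin n) : Measurable fun ω => A.B t ω i := by
  unfold B Problem.budget
  refine measurable_const.sub (Finset.measurable_fun_sum _ fun s _ => ?_)
  exact (measurable_consumption_apply i).comp
    ((measurable_pi_apply s).comp (A.measurable_hist (t - 1)))

theorem measurable_rhoAt (t : ℕ) (i : Fin n) : Measurable fun ω => A.rhoAt t ω i :=
  (A.measurable_B t i).div_const _

/-! ### Resampling -/

/-- Nothing before round `k` looks at the draw `k`. With `measurePreserving_update` this plays the
role of independence from the past. -/
theorem hist_update {t k : ℕ} (h : t < k) (ω : ℕ → Draw Θ Γ) (x : Draw Θ Γ) :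
    A.hist t (Function.update ω k x) = A.hist t ω := by
  induction t with
  | zero => rfl
  | succ t ih =>
    simp only [hist, ih (by omega), Function.update_of_ne h.ne]

theorem B_update {t k : ℕ} (hk : 1 ≤ k) (h : t ≤ k) (ω : ℕ → Draw Θ Γ) (x : Draw Θ Γ) :
    A.B t (Function.update ω k x) = A.B t ω := by
  rw [B, B, A.hist_update (by omega)]

theorem rhoAt_update {t k : ℕ} (hk : 1 ≤ k) (h : t ≤ k) (ω : ℕ → Draw Θ Γ) (x : Draw Θ Γ) :
    A.rhoAt t (Function.update ω k x) = A.rhoAt t ω := by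
  rw [rhoAt, rhoAt, A.hist_update (by omega)]

theorem control_update {t k : ℕ} (hk : 1 ≤ k) (h : t ≤ k) (ω : ℕ → Draw Θ Γ) (x : Draw Θ Γ) :
    A.control t (Function.update ω k x) = A.control t ω := by
  rw [control, control, A.hist_update (by omega)]

theorem outcome_update_self {k : ℕ} (hk : 1 ≤ k) (ω : ℕ → Draw Θ Γ) (x : Draw Θ Γ) :
    A.outcome k (Function.update ω k x) = play (A.control k ω) x := by
  rw [outcome, A.control_update hk le_rfl, Function.update_self]

theorem outcome_update {t k : ℕ} (hk : 1 ≤ k) (h : t < k) (ω : ℕ → Draw Θ Γ) (x : Draw Θ Γ) :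
    A.outcome t (Function.update ω k x) = A.outcome t ω := by
  rw [outcome, A.control_update hk h.le, Function.update_of_ne h.ne, outcome]

theorem measurePreserving_update (k : ℕ) :
    MeasurePreserving (fun p : (ℕ → Draw Θ Γ) × Draw Θ Γ => Function.update p.1 k p.2)
      (A.law.prod P.drawLaw) A.law := by
  refine ⟨measurable_pi_iff.2 fun j => ?_, map_update_infinitePi P.drawLaw k⟩
  by_cases hj : j = k
  · subst hj; simpa using measurable_snd
  · simp only [Function.update_of_ne hj]
    exact (measurable_pi_apply j).comp measurable_fst

/-- Integration may be carried out by first integrating over the draw of round `k`. -/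
theorem integral_eq_integral_update (k : ℕ) {F : (ℕ → Draw Θ Γ) → ℝ} (hF : Integrable F A.law) :
    ∫ ω, F ω ∂A.law = ∫ ω, ∫ x, F (Function.update ω k x) ∂P.drawLaw ∂A.law := by
  have hp := A.measurePreserving_update k
  rw [← integral_prod (fun p => F (Function.update p.1 k p.2))
    (hp.integrable_comp_of_integrable hF)]
  conv_lhs => rw [← hp.map_eq]
  exact integral_map hp.measurable.aemeasurable (by rw [hp.map_eq]; exact hF.aestronglyMeasurable)

/-! ### Budget dynamics and stopping times -/

theorem hist_castLE {s t : ℕ} (hs : s ≤ t) (ω : ℕ → Draw Θ Γ) :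
    (fun j : Fin s => A.hist t ω (Fin.castLE hs j)) = A.hist s ω := by
  induction t, hs using Nat.le_induction with
  | base => rfl
  | succ t hst ih =>
    rw [← ih]
    funext j
    have : Fin.castLE (hst.trans t.le_succ) j = Fin.castSucc (Fin.castLE hst j) := rfl
    rw [this]
    simp only [hist, Fin.snoc_castSucc]

theorem B_one (ω : ℕ → Draw Θ Γ) (i : Fin n) : A.B 1 ω i = P.rho i * T := by
  simp [B, Problem.budget]

theorem B_succ {t : ℕ} (ht : 1 ≤ t) (ω : ℕ → Draw Θ Γ) (i : Fin n) :
    A.B (t + 1) ω i = A.B t ω i - A.consumption t ω i := by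
  obtain ⟨t, rfl⟩ := Nat.exists_eq_add_of_le' ht
  change P.budget T (A.hist (t + 1) ω) i =
    P.budget T (A.hist t ω) i - P.c (A.outcome (t + 1) ω).1 (A.outcome (t + 1) ω).2.1
      (A.outcome (t + 1) ω).2.2 i
  simp only [Problem.budget, Fin.sum_univ_castSucc, hist, Fin.snoc_castSucc, Fin.snoc_last]
  exact (sub_sub _ _ _).symm

theorem B_eq (t : ℕ) (ω : ℕ → Draw Θ Γ) (i : Fin n) :
    A.B (t + 1) ω i = P.rho i * T - ∑ s ∈ Finset.Icc 1 t, A.consumption s ω i := by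
  induction t with
  | zero => simp [B_one]
  | succ t ih =>
    rw [A.B_succ (by omega), ih, Finset.sum_Icc_succ_top (by omega)]; ring

theorem rhoAt_mul {t : ℕ} (ht : 1 ≤ t) (htT : t ≤ T) (ω : ℕ → Draw Θ Γ) (i : Fin n) :
    A.rhoAt t ω i * ((T : ℝ) - t + 1) = A.B t ω i := by
  have h : ((T : ℝ) - (t - 1 : ℕ)) = T - t + 1 := by push_cast [ht]; ring
  have h0 : (T : ℝ) - t + 1 ≠ 0 := by
    have : (t : ℝ) ≤ T := by exact_mod_cast htT
    linarith
  rw [rhoAt, Problem.avgBudget, h, div_mul_cancel₀ _ h0, B]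

theorem rhoAt_one (hT : 1 ≤ T) (ω : ℕ → Draw Θ Γ) (i : Fin n) : A.rhoAt 1 ω i = P.rho i := by
  have h := A.rhoAt_mul le_rfl hT ω i
  have : (T : ℝ) ≠ 0 := by positivity
  rw [B_one] at h
  push_cast at h
  rw [sub_add_cancel] at h
  exact mul_right_cancel₀ this h

theorem rhoAt_succ {t : ℕ} (ht : 1 ≤ t) (htT : t < T) (ω : ℕ → Draw Θ Γ) (i : Fin n) :
    A.rhoAt (t + 1) ω i =
      A.rhoAt t ω i + (A.rhoAt t ω i - A.consumption t ω i) / ((T : ℝ) - t) := by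
  have h0 : (T : ℝ) - t ≠ 0 := by
    have : (t : ℝ) < T := by exact_mod_cast htT
    linarith
  have h1 := A.rhoAt_mul ht htT.le ω i
  have h2 := A.rhoAt_mul (by omega) htT ω i
  rw [A.B_succ ht] at h2
  push_cast at h2
  field_simp
  linarith

/-- A deviation in round `s` is spread over the `T - s` rounds that remain, which is the origin of
the weights `1/(T - s)` in `gC`. -/
theorem rhoAt_eq {t : ℕ} (ht : 1 ≤ t) (htT : t ≤ T) (ω : ℕ → Draw Θ Γ) (i : Fin n) :
    A.rhoAt t ω i = P.rho i +
      ∑ s ∈ Finset.Ico 1 t, (A.rhoAt s ω i - A.consumption s ω i) / ((T : ℝ) - s) := by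
  induction t, ht using Nat.le_induction with
  | base => simp [A.rhoAt_one htT]
  | succ t ht ih =>
    rw [A.rhoAt_succ ht htT, ih (by omega), Finset.sum_Ico_succ_top ht]
    conv_rhs => rw [← add_assoc, ← ih (by omega)]
    rw [← ih (by omega)]

theorem T0_le (ω : ℕ → Draw Θ Γ) : A.T0 ω ≤ T := Nat.sInf_le (Or.inr rfl)

/-- The condition on the right involves only budgets up to the start of round `t`, which makes the
event measurable and insensitive to the draw of round `t`. -/
theorem le_T0_iff {t : ℕ} {ω : ℕ → Draw Θ Γ} :
    t ≤ A.T0 ω ↔ t ≤ T ∧ ∀ s, 1 ≤ s → s < t → ∀ i, 1 ≤ A.B (s + 1) ω i := by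
  rw [T0, le_csInf_iff (OrderBot.bddBelow _) ⟨T, Or.inr rfl⟩]
  constructor
  · intro h
    refine ⟨h T (Or.inr rfl), fun s hs hst i => ?_⟩
    by_contra hB
    have := h s (Or.inl ⟨hs, i, not_le.1 hB⟩)
    omega
  · rintro ⟨hT, h⟩ s (⟨hs, i, hB⟩ | rfl)
    · by_contra hst
      exact absurd (h s hs (not_le.1 hst) i) (not_le.2 hB)
    · exact hT

theorem Te_le_T0 (δ : ℝ) (φ₁ : Θ → ℝ) (ω : ℕ → Draw Θ Γ) : A.Te δ φ₁ ω ≤ A.T0 ω := min_le_left _ _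

theorem Te_le (δ : ℝ) (φ₁ : Θ → ℝ) (ω : ℕ → Draw Θ Γ) : A.Te δ φ₁ ω ≤ T :=
  (A.Te_le_T0 δ φ₁ ω).trans (A.T0_le ω)

theorem le_Te_iff {δ : ℝ} {φ₁ : Θ → ℝ} {t : ℕ} {ω : ℕ → Draw Θ Γ} :
    t ≤ A.Te δ φ₁ ω ↔ t ≤ A.T0 ω ∧
      ∀ s, 1 ≤ s → s ≤ t → A.rhoAt s ω ∈ nbhd P.rho δ (P.binding φ₁) := by
  rw [Te, le_min_iff]
  refine and_congr_right fun hT0 => ?_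
  -- The inner infimum is at least one, so the truncated subtraction in `Te` is a true one.
  rw [Nat.le_sub_iff_add_le' (le_csInf ⟨T + 1, Or.inr rfl⟩ ?_),
    le_csInf_iff (OrderBot.bddBelow _) ⟨T + 1, Or.inr rfl⟩]
  · constructor
    · intro h s hs hst
      by_contra hN
      have := h s (Or.inl ⟨hs, hN⟩)
      omega
    · rintro h s (⟨hs, hN⟩ | rfl)
      · by_contra hst
        exact hN (h s hs (by omega))
      · have := A.T0_le ω
        omega
  · rintro s (⟨hs, -⟩ | rfl) <;> omega

theorem running_of_le_T0 {t : ℕ} {ω : ℕ → Draw Θ Γ} (h : t ≤ A.T0 ω) :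
    P.Running T (A.hist (t - 1) ω) := by
  intro s hs hst i
  rw [A.hist_castLE hst]
  exact (A.le_T0_iff.1 h).2 s hs (by omega) i

/-- Optimality, and with it the range `[0, 1]`, is only guaranteed on running histories; after `T0`
the formal continuation of `phiHat` may take any real values. -/
theorem isControl_of_le_T0 {t : ℕ} (ht : 1 ≤ t) {ω : ℕ → Draw Θ Γ} (h : t ≤ A.T0 ω) :
    IsControl (A.control t ω) :=
  (A.optimal (t - 1) (by have := A.T0_le ω; omega) _ (A.running_of_le_T0 h)).1.1

/-- `meanConsumption` centres the consumption in every round, even where the control is not `[0,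
1]`-valued, so the noise can be defined without reference to `T0`. In executed rounds it is the
quantity that the accuracy events control. -/
theorem meanConsumption_eq {t : ℕ} (ht : 1 ≤ t) {ω : ℕ → Draw Θ Γ} (h : t ≤ A.T0 ω) (i : Fin n) :
    A.meanConsumption t ω i = P.ctrlConsumption (A.control t ω) i :=
  P.integral_consumption_play (A.isControl_of_le_T0 ht h) i

theorem measurableSet_le_T0 (t : ℕ) : MeasurableSet {ω | t ≤ A.T0 ω} := by
  simp only [A.le_T0_iff, Set.ofPred_and, Set.ofPred_forall]
  refine (MeasurableSet.const _).inter (MeasurableSet.iInter fun s => MeasurableSet.iInter fun _ =>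
    MeasurableSet.iInter fun _ => MeasurableSet.iInter fun i => ?_)
  exact measurableSet_le measurable_const (A.measurable_B _ i)

theorem measurableSet_nbhd (rho : Fin n → ℝ) (δ : ℝ) (S : Set (Fin n)) :
    MeasurableSet (nbhd rho δ S) := by
  simp only [nbhd, Set.ofPred_and, Set.ofPred_forall]
  refine MeasurableSet.inter ?_ (MeasurableSet.inter ?_ ?_)
  · exact MeasurableSet.iInter fun i => measurableSet_le measurable_const (measurable_pi_apply i)
  · exact MeasurableSet.iInter fun i => MeasurableSet.iInter fun _ => measurableSet_le
      ((measurable_pi_apply i).sub_const _).norm measurable_const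
  · exact MeasurableSet.iInter fun i => MeasurableSet.iInter fun _ => measurableSet_le
      measurable_const ((measurable_pi_apply i).sub_const _)

theorem measurableSet_rhoAt_mem (δ : ℝ) (S : Set (Fin n)) (t : ℕ) :
    MeasurableSet {ω | A.rhoAt t ω ∈ nbhd P.rho δ S} :=
  measurableSet_nbhd P.rho δ S |>.preimage (measurable_pi_iff.2 (A.measurable_rhoAt t))

theorem measurableSet_rhoAt_mem_upto (δ : ℝ) (S : Set (Fin n)) (t : ℕ) :
    MeasurableSet {ω | ∀ s, 1 ≤ s → s ≤ t → A.rhoAt s ω ∈ nbhd P.rho δ S} := by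
  simp only [Set.ofPred_forall]
  exact MeasurableSet.iInter fun s => MeasurableSet.iInter fun _ => MeasurableSet.iInter fun _ =>
    A.measurableSet_rhoAt_mem δ S s

theorem measurableSet_le_Te (δ : ℝ) (φ₁ : Θ → ℝ) (t : ℕ) :
    MeasurableSet {ω | t ≤ A.Te δ φ₁ ω} := by
  simp only [A.le_Te_iff, Set.ofPred_and]
  exact (A.measurableSet_le_T0 t).inter (A.measurableSet_rhoAt_mem_upto δ _ t)

theorem le_T0_update {t k : ℕ} (hk : 1 ≤ k) (h : t ≤ k) (ω : ℕ → Draw Θ Γ) (x : Draw Θ Γ) :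
    t ≤ A.T0 (Function.update ω k x) ↔ t ≤ A.T0 ω := by
  rw [A.le_T0_iff, A.le_T0_iff]
  refine and_congr_right fun _ => forall_congr' fun s => forall₂_congr fun _ hs => ?_
  rw [A.B_update hk (by omega)]

theorem rhoAt_mem_upto_update {δ : ℝ} {S : Set (Fin n)} {t k : ℕ} (hk : 1 ≤ k) (h : t ≤ k)
    (ω : ℕ → Draw Θ Γ) (x : Draw Θ Γ) :
    (∀ s, 1 ≤ s → s ≤ t → A.rhoAt s (Function.update ω k x) ∈ nbhd P.rho δ S) ↔
      ∀ s, 1 ≤ s → s ≤ t → A.rhoAt s ω ∈ nbhd P.rho δ S := by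
  refine forall_congr' fun s => forall₂_congr fun _ hs => ?_
  rw [A.rhoAt_update hk (by omega)]

theorem le_Te_update {δ : ℝ} {φ₁ : Θ → ℝ} {k : ℕ} (hk : 1 ≤ k)
    (ω : ℕ → Draw Θ Γ) (x : Draw Θ Γ) :
    k ≤ A.Te δ φ₁ (Function.update ω k x) ↔ k ≤ A.Te δ φ₁ ω := by
  rw [A.le_Te_iff, A.le_Te_iff, A.le_T0_update hk le_rfl,
    A.rhoAt_mem_upto_update hk le_rfl]

end ReSolving

end CBwK

/-! ### Concentration of the consumption noise -/

namespace CBwK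

/-- Telescoping: with `m = T - s`, one has `1/m² ≤ 1/(m - 1) - 1/m`. -/
theorem sum_inv_sq_le {T t : ℕ} (ht : 1 ≤ t) (htT : t < T) :
    ∑ s ∈ Finset.Ico 1 t, (1 / ((T : ℝ) - s)) ^ 2 ≤ 1 / ((T : ℝ) - t) := by
  induction t, ht using Nat.le_induction with
  | base =>
    have : (1 : ℝ) < T := by exact_mod_cast htT
    simp only [Finset.Ico_self, Finset.sum_empty]
    exact one_div_nonneg.2 (by push_cast; linarith)
  | succ t ht ih =>
    rw [Finset.sum_Ico_succ_top ht]
    have h1 := ih (by omega)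
    have h2 : (t : ℝ) + 1 < T := by exact_mod_cast htT
    have h3 : 1 / ((T : ℝ) - t) + (1 / ((T : ℝ) - t)) ^ 2 ≤ 1 / ((T : ℝ) - (t + 1 : ℕ)) := by
      push_cast
      have hm : 0 < (T : ℝ) - t - 1 := by linarith
      have hm' : 0 < (T : ℝ) - t := by linarith
      rw [show (T : ℝ) - (t + 1) = T - t - 1 by ring, div_pow, div_add_div _ _ hm'.ne' (by positivity),
        div_le_div_iff₀ (by positivity) hm]
      nlinarith [mul_pos hm' hm]
    linarith

namespace ReSolving

variable {n : ℕ} {Θ Γ : Type*} [MeasurableSpace Θ] [MeasurableSpace Γ] {P : Problem n Θ Γ}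
  {T : ℕ} {fb : Feedback} (A : ReSolving P T fb)

/-- The centred consumption of round `t`, in units of the average budget and stopped when the
average budget leaves the neighbourhood. -/
def noise (δ : ℝ) (S : Set (Fin n)) (i : Fin n) (t : ℕ) : (ℕ → Draw Θ Γ) → ℝ :=
  {ω | ∀ s, 1 ≤ s → s ≤ t → A.rhoAt s ω ∈ nbhd P.rho δ S}.indicator fun ω =>
    (A.meanConsumption t ω i - A.consumption t ω i) / ((T : ℝ) - t)

/-- The martingale of the centred consumptions before round `t`. -/
def noiseSum (δ : ℝ) (S : Set (Fin n)) (i : Fin n) (t : ℕ) (ω : ℕ → Draw Θ Γ) : ℝ :=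
  ∑ s ∈ Finset.Ico 1 t, A.noise δ S i s ω

variable (δ : ℝ) (S : Set (Fin n)) (i : Fin n)

theorem noise_of_mem {t : ℕ} {ω : ℕ → Draw Θ Γ}
    (h : ∀ s, 1 ≤ s → s ≤ t → A.rhoAt s ω ∈ nbhd P.rho δ S) :
    A.noise δ S i t ω = (A.meanConsumption t ω i - A.consumption t ω i) / ((T : ℝ) - t) :=
  Set.indicator_of_mem (by exact h) _

theorem noise_of_not_mem {t : ℕ} {ω : ℕ → Draw Θ Γ}
    (h : ¬ ∀ s, 1 ≤ s → s ≤ t → A.rhoAt s ω ∈ nbhd P.rho δ S) : A.noise δ S i t ω = 0 :=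
  Set.indicator_of_notMem (by exact h) _

theorem measurable_noise (t : ℕ) : Measurable (A.noise δ S i t) :=
  (((A.measurable_meanConsumption t i).sub (A.measurable_consumption t i)).div_const _).indicator
    (A.measurableSet_rhoAt_mem_upto δ S t)

theorem measurable_noiseSum (t : ℕ) : Measurable (A.noiseSum δ S i t) :=
  Finset.measurable_fun_sum _ fun s _ => A.measurable_noise δ S i s

theorem abs_noise_le (t : ℕ) (ω : ℕ → Draw Θ Γ) : |A.noise δ S i t ω| ≤ |1 / ((T : ℝ) - t)| := by
  by_cases h : ∀ s, 1 ≤ s → s ≤ t → A.rhoAt s ω ∈ nbhd P.rho δ S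
  swap
  · rw [A.noise_of_not_mem δ S i h, abs_zero]
    exact abs_nonneg _
  rw [A.noise_of_mem δ S i h, abs_div, abs_div, abs_one]
  have h1 := A.meanConsumption_mem t ω i
  have h2 := A.consumption_mem t ω i
  gcongr
  rw [abs_le]
  constructor <;> linarith [h1.1, h1.2, h2.1, h2.2]

theorem integrable_exp_noiseSum (l : ℝ) (t : ℕ) :
    Integrable (fun ω => Real.exp (l * A.noiseSum δ S i t ω)) A.law := by
  refine ProbabilityTheory.integrable_exp_mul_of_mem_Icc
    (a := -∑ s ∈ Finset.Ico 1 t, |1 / ((T : ℝ) - s)|) (b := ∑ s ∈ Finset.Ico 1 t, |1 / ((T : ℝ) - s)|)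
    (A.measurable_noiseSum δ S i t).aemeasurable (Filter.Eventually.of_forall fun ω => ?_)
  exact abs_le.1 ((Finset.abs_sum_le_sum_abs _ _).trans
    (Finset.sum_le_sum fun s _ => A.abs_noise_le δ S i s ω))

theorem meanConsumption_update {t k : ℕ} (hk : 1 ≤ k) (h : t ≤ k) (ω : ℕ → Draw Θ Γ)
    (x : Draw Θ Γ) : A.meanConsumption t (Function.update ω k x) = A.meanConsumption t ω := by
  funext i
  rw [meanConsumption, A.control_update hk h, meanConsumption]

theorem noiseSum_update {k : ℕ} (hk : 1 ≤ k) (ω : ℕ → Draw Θ Γ) (x : Draw Θ Γ) :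
    A.noiseSum δ S i k (Function.update ω k x) = A.noiseSum δ S i k ω := by
  refine Finset.sum_congr rfl fun s hs => ?_
  have hs := Finset.mem_Ico.1 hs
  have hN := A.rhoAt_mem_upto_update (δ := δ) (S := S) hk hs.2.le ω x
  by_cases h : ∀ r, 1 ≤ r → r ≤ s → A.rhoAt r ω ∈ nbhd P.rho δ S
  · rw [A.noise_of_mem δ S i h, A.noise_of_mem δ S i (hN.2 h),
      A.meanConsumption_update hk hs.2.le, consumption, A.outcome_update hk hs.2, consumption]
  · rw [A.noise_of_not_mem δ S i h, A.noise_of_not_mem δ S i (mt hN.1 h)]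

/-- Hoeffding's lemma with the past fixed: given `ω`, the redrawn noise is either zero or centred
with values in an interval of length `1/(T - k)`. -/
theorem integral_exp_noise_update_le (l : ℝ) {k : ℕ} (hk : 1 ≤ k) (hkT : k < T)
    (ω : ℕ → Draw Θ Γ) :
    ∫ x, Real.exp (l * A.noise δ S i k (Function.update ω k x)) ∂P.drawLaw ≤
      Real.exp (l ^ 2 / 8 * (1 / ((T : ℝ) - k)) ^ 2) := by
  have hpos : 0 < (T : ℝ) - k := by
    have : (k : ℝ) < T := by exact_mod_cast hkT
    linarith
  have hup := A.rhoAt_mem_upto_update (δ := δ) (S := S) hk le_rfl ω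
  by_cases hN : ∀ s, 1 ≤ s → s ≤ k → A.rhoAt s ω ∈ nbhd P.rho δ S
  · simp only [A.noise_of_mem δ S i ((hup _).2 hN), A.meanConsumption_update hk le_rfl, consumption,
      A.outcome_update_self hk]
    set c : Draw Θ Γ → ℝ := fun x => P.c (play (A.control k ω) x).1
      (play (A.control k ω) x).2.1 (play (A.control k ω) x).2.2 i with hc
    have hcm : Measurable c := (measurable_consumption_apply (P := P) i).comp
      ((A.measurable_play_control k).comp measurable_prodMk_left)
    have hc1 : ∀ x, c x ∈ Set.Icc (0 : ℝ) 1 := fun x => P.c_mem _ _ _ _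
    have hci : Integrable c P.drawLaw :=
      Integrable.of_mem_Icc 0 1 hcm.aemeasurable (Filter.Eventually.of_forall hc1)
    set m := A.meanConsumption k ω i with hm
    have hmc : m = ∫ x, c x ∂P.drawLaw := rfl
    have h := (ProbabilityTheory.hasSubgaussianMGF_of_mem_Icc_of_integral_eq_zero
      (μ := P.drawLaw) (X := fun x => (m - c x) / ((T : ℝ) - k))
      (a := (m - 1) / ((T : ℝ) - k)) (b := m / ((T : ℝ) - k))
      ((measurable_const.sub hcm).div_const _).aemeasurable
      (Filter.Eventually.of_forall fun x => ⟨?_, ?_⟩) ?_).mgf_le l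
    · refine h.trans (le_of_eq ?_)
      congr 1
      have : m / ((T : ℝ) - k) - (m - 1) / ((T : ℝ) - k) = 1 / ((T : ℝ) - k) := by ring
      rw [this]
      push_cast
      rw [Real.norm_of_nonneg (by positivity)]
      ring
    · have := (hc1 x).2
      gcongr
    · have := (hc1 x).1
      gcongr
      linarith
    · rw [integral_div, integral_sub (integrable_const _) hci, ← hmc]
      simp
  · simp only [A.noise_of_not_mem δ S i (mt (hup _).1 hN), mul_zero, Real.exp_zero, integral_const, probReal_univ, smul_eq_mul, mul_one]
    exact Real.one_le_exp (by positivity)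

theorem integral_exp_noiseSum_le (l : ℝ) {t : ℕ} (ht : 1 ≤ t) (htT : t ≤ T) :
    ∫ ω, Real.exp (l * A.noiseSum δ S i t ω) ∂A.law ≤
      Real.exp (l ^ 2 / 8 * ∑ s ∈ Finset.Ico 1 t, (1 / ((T : ℝ) - s)) ^ 2) := by
  induction t, ht using Nat.le_induction with
  | base => simp [noiseSum]
  | succ t ht ih =>
    -- Redrawing round `t` changes only the last increment; the earlier partial sum factors out of
    -- the inner integral.
    rw [A.integral_eq_integral_update t (A.integrable_exp_noiseSum δ S i l (t + 1))]
    have h (ω : ℕ → Draw Θ Γ) :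
        ∫ x, Real.exp (l * A.noiseSum δ S i (t + 1) (Function.update ω t x)) ∂P.drawLaw ≤
          Real.exp (l * A.noiseSum δ S i t ω) *
            Real.exp (l ^ 2 / 8 * (1 / ((T : ℝ) - t)) ^ 2) := by
      have h1 (x : Draw Θ Γ) : Real.exp (l * A.noiseSum δ S i (t + 1) (Function.update ω t x)) =
          Real.exp (l * A.noiseSum δ S i t ω) *
            Real.exp (l * A.noise δ S i t (Function.update ω t x)) := by
        rw [← Real.exp_add, ← mul_add, noiseSum, Finset.sum_Ico_succ_top ht,
          ← A.noiseSum_update δ S i ht ω x, noiseSum]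
      simp only [h1, integral_const_mul]
      gcongr
      exact A.integral_exp_noise_update_le δ S i l ht htT ω
    refine (integral_mono_of_nonneg (Filter.Eventually.of_forall fun ω =>
      integral_nonneg fun x => (Real.exp_pos _).le)
      ((A.integrable_exp_noiseSum δ S i l t).mul_const _) (Filter.Eventually.of_forall h)).trans ?_
    rw [integral_mul_const, Finset.sum_Ico_succ_top ht, mul_add, Real.exp_add]
    gcongr
    exact ih (by omega)

theorem measure_noiseSum_ge_le (hδ : 0 < δ) {t : ℕ} (ht : 1 ≤ t) (htT : t ≤ T) :
    A.law.real {ω | δ / 2 ≤ |A.noiseSum δ S i t ω|} ≤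
      2 * Real.exp (-(δ ^ 2 / 2) * ((T : ℝ) - t)) := by
  -- At `t = T` the variance bound `1/(T - t)` is meaningless, but the claimed bound is two.
  rcases htT.eq_or_lt with rfl | htT
  · refine measureReal_le_one.trans ?_
    simp
  have hm : 0 < (T : ℝ) - t := by
    have : (t : ℝ) < T := by exact_mod_cast htT
    linarith
  set m := (T : ℝ) - t with hmdef
  -- `l = ±2δm` are the Chernoff parameters that minimise `-|l| δ/2 + l²/(8m)`, one for each tail.
  have hmgf (l : ℝ) (hl : l ^ 2 = (2 * δ * m) ^ 2) :
      ProbabilityTheory.mgf (A.noiseSum δ S i t) A.law l ≤ Real.exp (δ ^ 2 * m / 2) := by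
    refine (A.integral_exp_noiseSum_le δ S i l ht htT.le).trans (Real.exp_le_exp.2 ?_)
    have h := mul_le_mul_of_nonneg_left (sum_inv_sq_le ht htT) (by positivity : 0 ≤ l ^ 2 / 8)
    refine h.trans (le_of_eq ?_)
    rw [hl, ← hmdef]
    field_simp
    ring
  have hset : {ω | δ / 2 ≤ |A.noiseSum δ S i t ω|} =
      {ω | δ / 2 ≤ A.noiseSum δ S i t ω} ∪ {ω | A.noiseSum δ S i t ω ≤ -(δ / 2)} := by
    ext ω
    simp only [Set.mem_ofPred_eq, Set.mem_union, le_abs]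
    exact or_congr_right le_neg
  have h1 := (ProbabilityTheory.measure_ge_le_exp_mul_mgf (δ / 2) (by positivity : 0 ≤ 2 * δ * m)
    (A.integrable_exp_noiseSum δ S i _ t)).trans
      (mul_le_mul_of_nonneg_left (hmgf _ rfl) (Real.exp_pos _).le)
  have h2 := (ProbabilityTheory.measure_le_le_exp_mul_mgf (-(δ / 2))
    (by nlinarith [mul_pos hδ hm] : -(2 * δ * m) ≤ 0)
    (A.integrable_exp_noiseSum δ S i _ t)).trans
      (mul_le_mul_of_nonneg_left (hmgf _ (neg_sq _)) (Real.exp_pos _).le)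
  rw [← Real.exp_add] at h1 h2
  have e1 : -(2 * δ * m) * (δ / 2) + δ ^ 2 * m / 2 = -(δ ^ 2 / 2) * m := by ring
  have e2 : -(-(2 * δ * m)) * -(δ / 2) + δ ^ 2 * m / 2 = -(δ ^ 2 / 2) * m := by ring
  rw [e1] at h1
  rw [e2] at h2
  rw [hset]
  linarith [measureReal_union_le (μ := A.law) {ω | δ / 2 ≤ A.noiseSum δ S i t ω}
    {ω | A.noiseSum δ S i t ω ≤ -(δ / 2)}]

end ReSolving

end CBwK

/-! ### Probability that `Te` comes early -/

namespace CBwK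

theorem gC_nonneg {T : ℕ} {f : ℕ → ℝ → ℝ} {t : ℕ} {b : ℝ}
    (hf : ∀ τ ∈ Finset.Ico 1 t, ∀ d ∈ Set.Icc (0 : ℝ) 1, 0 ≤ f τ d) : 0 ≤ gC T f t b := by
  refine Real.sInf_nonneg ?_
  rintro _ ⟨d, hd, rfl⟩
  exact Finset.sum_nonneg fun τ hτ => hf τ hτ _ (hd.1 τ hτ)

theorem le_gC {T : ℕ} {f : ℕ → ℝ → ℝ} {t : ℕ} {b a : ℝ} (hb : 0 ≤ b)
    (h : ∀ d : ℕ → ℝ, (∀ τ ∈ Finset.Ico 1 t, d τ ∈ Set.Icc (0 : ℝ) 1) →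
      ∑ τ ∈ Finset.Ico 1 t, d τ / ((T : ℝ) - τ) ≤ b → a ≤ ∑ τ ∈ Finset.Ico 1 t, f τ (d τ)) :
    a ≤ gC T f t b := by
  -- The zero levels are admissible, so the infimum is not the default value on the empty set.
  refine le_csInf ⟨_, fun _ => 0, ⟨fun _ _ => by simp, by simpa using hb⟩, rfl⟩ ?_
  rintro _ ⟨d, hd, rfl⟩
  exact h d hd.1 hd.2

theorem le_of_mem_nbhd {n : ℕ} {rho κ : Fin n → ℝ} {δ : ℝ} {S : Set (Fin n)}
    (h : κ ∈ nbhd rho δ S) (i : Fin n) : rho i - δ ≤ κ i := by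
  by_cases hi : i ∈ S
  · linarith [(abs_le.1 (h.2.1 i hi)).1]
  · linarith [h.2.2 i hi]

/-- Outside the neighbourhood, a binding coordinate is off by more than `δ`, or another one is
more than `δ` too small. -/
theorem exists_of_not_mem_nbhd {n : ℕ} {rho κ : Fin n → ℝ} {δ : ℝ} {S : Set (Fin n)}
    (hδ : 0 < δ) (hrho : ∀ i, δ < rho i / 2) (h : κ ∉ nbhd rho δ S) :
    ∃ i, (i ∈ S ∧ δ < |κ i - rho i|) ∨ κ i - rho i < -δ := by
  by_contra! hc
  refine h ⟨fun i => ?_, fun i hi => (hc i).1 hi, fun i _ => (hc i).2⟩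
  linarith [(hc i).2, hrho i]

namespace ReSolving

variable {n : ℕ} {Θ Γ : Type*} [MeasurableSpace Θ] [MeasurableSpace Γ] {P : Problem n Θ Γ}
  {T : ℕ} {fb : Feedback} (A : ReSolving P T fb)

/-- Inside the neighbourhood every average budget exceeds `ρ - δ > δ`, so at least `δ (T - t + 1) ≥
1` units remain. Unless few rounds are left, running out of budget therefore requires leaving the
neighbourhood. -/
theorem le_T0_of_rhoAt_mem {δ : ℝ} {S : Set (Fin n)} (hrho : ∀ i, δ < P.rho i / 2)
    {t : ℕ} (htT : t ≤ T) (hlong : 1 ≤ δ * ((T : ℝ) - t + 1)) {ω : ℕ → Draw Θ Γ}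
    (hN : ∀ s, 1 ≤ s → s ≤ t → A.rhoAt s ω ∈ nbhd P.rho δ S) : t ≤ A.T0 ω := by
  refine A.le_T0_iff.2 ⟨htT, fun s hs hst i => ?_⟩
  rw [← A.rhoAt_mul (by omega) (by omega)]
  have h1 := le_of_mem_nbhd (hN (s + 1) (by omega) hst) i
  have h2 := hrho i
  have h3 : (s : ℝ) + 1 ≤ t := by exact_mod_cast hst
  have h4 : (t : ℝ) ≤ T := by exact_mod_cast htT
  push_cast
  have h5 : (T : ℝ) - t + 1 ≤ T - (s + 1) + 1 := by linarith
  have hδ : 0 < δ := by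
    by_contra hδ
    nlinarith
  calc (1 : ℝ) ≤ δ * ((T : ℝ) - t + 1) := hlong
    _ ≤ A.rhoAt (s + 1) ω i * ((T : ℝ) - (s + 1) + 1) :=
      mul_le_mul (by linarith) h5 (by linarith) (by linarith)

/-- If the average budget leaves the neighbourhood early although all controls were accurate,
then the noise is large. -/
theorem exists_noiseSum_ge {δ : ℝ} (hδ : 0 < δ) (hrho : ∀ i, δ < P.rho i / 2) {φ₁ : Θ → ℝ}
    {t : ℕ} (htT : t ≤ T) (hlong : 1 ≤ δ * ((T : ℝ) - t + 1)) {d : ℕ → ℝ}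
    (hd : ∀ τ ∈ Finset.Ico 1 t, d τ ∈ Set.Icc (0 : ℝ) 1)
    (hsum : ∑ τ ∈ Finset.Ico 1 t, d τ / ((T : ℝ) - τ) ≤ δ / 2) {ω : ℕ → Draw Θ Γ}
    (hacc : ∀ τ ∈ Finset.Ico 1 t, ω ∈ A.accurate δ φ₁ τ (d τ)) (hTe : ¬ t ≤ A.Te δ φ₁ ω) :
    ∃ i, δ / 2 ≤ |A.noiseSum δ (P.binding φ₁) i t ω| := by
  classical
  set S := P.binding φ₁ with hS
  have hex : ∃ s, 1 ≤ s ∧ s ≤ t ∧ A.rhoAt s ω ∉ nbhd P.rho δ S := by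
    by_contra! hc
    exact hTe (A.le_Te_iff.2 ⟨A.le_T0_of_rhoAt_mem hrho htT hlong hc, hc⟩)
  obtain ⟨hs1, hst, hsN⟩ := Nat.find_spec hex
  have hmin (r : ℕ) (hr : 1 ≤ r) (hrs : r < Nat.find hex) : A.rhoAt r ω ∈ nbhd P.rho δ S := by
    by_contra hc
    exact Nat.find_min hex hrs ⟨hr, by omega, hc⟩
  generalize Nat.find hex = s at hs1 hst hsN hmin
  have htT' : (t : ℝ) ≤ T := by exact_mod_cast htT
  have hpos (τ : ℕ) (hτ : τ < t) : 0 < (T : ℝ) - τ := by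
    have : (τ : ℝ) < t := by exact_mod_cast hτ
    linarith
  have hrun (τ : ℕ) (hτ : τ < s) : τ ≤ A.T0 ω := by
    refine A.le_T0_of_rhoAt_mem hrho (by omega) (hlong.trans ?_)
      fun r hr hrτ => hmin r hr (by omega)
    gcongr
    omega
  have hacc' (τ : ℕ) (hτ : τ ∈ Finset.Ico 1 s) :
      (∀ i ∈ S, |A.rhoAt τ ω i - A.meanConsumption τ ω i| ≤ d τ) ∧
        ∀ i ∉ S, -d τ ≤ A.rhoAt τ ω i - A.meanConsumption τ ω i := by
    have hτ' := Finset.mem_Ico.1 hτ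
    have h := hacc τ (Finset.mem_Ico.2 ⟨hτ'.1, by omega⟩) (hrun τ hτ'.2) (hmin τ hτ'.1 hτ'.2)
    simp only [A.meanConsumption_eq hτ'.1 (hrun τ hτ'.2)]
    exact h
  have hsum' : ∑ τ ∈ Finset.Ico 1 s, d τ / ((T : ℝ) - τ) ≤ δ / 2 := by
    refine (Finset.sum_le_sum_of_subset_of_nonneg (Finset.Ico_subset_Ico_right hst)
      fun τ hτ _ => ?_).trans hsum
    exact div_nonneg (hd τ hτ).1 (hpos τ (Finset.mem_Ico.1 hτ).2).le
  -- From the exit time `s` on the noise vanishes, so its sum up to `t` is the displacement at time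
  -- `s` minus the drift.
  have hnoise (i : Fin n) : A.noiseSum δ S i t ω = A.rhoAt s ω i - P.rho i -
      ∑ τ ∈ Finset.Ico 1 s, (A.rhoAt τ ω i - A.meanConsumption τ ω i) / ((T : ℝ) - τ) := by
    rw [A.rhoAt_eq hs1 (hst.trans htT), add_sub_cancel_left, ← Finset.sum_sub_distrib, noiseSum,
      ← Finset.sum_Ico_consecutive _ hs1 hst, Finset.sum_eq_zero (s := Finset.Ico s t), add_zero]
    · refine Finset.sum_congr rfl fun τ hτ => ?_
      have hτ' := Finset.mem_Ico.1 hτ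
      rw [A.noise_of_mem δ S i fun r hr hrτ => hmin r hr (by omega)]
      ring
    · intro τ hτ
      exact A.noise_of_not_mem δ S i fun h => hsN (h s hs1 (Finset.mem_Ico.1 hτ).1)
  have hlower (i : Fin n) : -(δ / 2) ≤
      ∑ τ ∈ Finset.Ico 1 s, (A.rhoAt τ ω i - A.meanConsumption τ ω i) / ((T : ℝ) - τ) := by
    refine (neg_le_neg hsum').trans ?_
    rw [← Finset.sum_neg_distrib]
    refine Finset.sum_le_sum fun τ hτ => ?_
    rw [← neg_div]
    have := hpos τ (by have := Finset.mem_Ico.1 hτ; omega)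
    gcongr
    by_cases hi : i ∈ S
    · exact (abs_le.1 ((hacc' τ hτ).1 i hi)).1
    · exact (hacc' τ hτ).2 i hi
  -- An upward exit occurs only in a binding coordinate, where accuracy is two-sided; for a downward
  -- exit the lower bound on the drift is enough.
  obtain ⟨i, ⟨hi, hdev⟩ | hdev⟩ := exists_of_not_mem_nbhd hδ hrho hsN
  · refine ⟨i, ?_⟩
    have hupper : ∑ τ ∈ Finset.Ico 1 s, (A.rhoAt τ ω i - A.meanConsumption τ ω i) / ((T : ℝ) - τ) ≤
        δ / 2 := by
      refine le_trans (Finset.sum_le_sum fun τ hτ => ?_) hsum'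
      have := hpos τ (by have := Finset.mem_Ico.1 hτ; omega)
      gcongr
      exact (abs_le.1 ((hacc' τ hτ).1 i hi)).2
    have h := hlower i
    rw [hnoise]
    rcases lt_abs.1 hdev with hdev | hdev
    · exact le_abs.2 (Or.inl (by linarith))
    · exact le_abs.2 (Or.inr (by linarith))
  · refine ⟨i, le_abs.2 (Or.inr ?_)⟩
    rw [hnoise]
    linarith [hlower i]

/-- For early rounds, a union bound over accuracy failures and over the two noise tails of each
resource gives `gC` and the `2n`. The `3` covers the last rounds, about `1/δ` in number, in which
the budget may run out inside the neighbourhood. -/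
theorem measure_not_le_Te_le (hn : 0 < n) {δ : ℝ} (hδ : 0 < δ) (hrho : ∀ i, δ < P.rho i / 2)
    {φ₁ : Θ → ℝ} {fC : ℕ → ℝ → ℝ}
    (hfC : ∀ t ∈ Finset.Icc 1 (T - 1), ∀ d ∈ Set.Icc (0 : ℝ) 1,
      A.law.real (A.accurate δ φ₁ t d)ᶜ ≤ fC t d) {t : ℕ} (ht : 1 ≤ t) (htT : t ≤ T) :
    A.law.real {ω | ¬ t ≤ A.Te δ φ₁ ω} ≤
      gC T fC t (δ / 2) + (2 * n + 3) * Real.exp (-(δ ^ 2 / 2) * ((T : ℝ) - t)) := by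
  have hmem {τ : ℕ} (hτ : τ ∈ Finset.Ico 1 t) : τ ∈ Finset.Icc 1 (T - 1) := by
    simp only [Finset.mem_Ico, Finset.mem_Icc] at *
    omega
  have htT' : (t : ℝ) ≤ T := by exact_mod_cast htT
  set e := Real.exp (-(δ ^ 2 / 2) * ((T : ℝ) - t)) with he
  have he0 : 0 < e := Real.exp_pos _
  by_cases hlong : 1 ≤ δ * ((T : ℝ) - t + 1)
  · suffices h : A.law.real {ω | ¬ t ≤ A.Te δ φ₁ ω} - n * (2 * e) ≤ gC T fC t (δ / 2) by
      nlinarith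
    refine le_gC (by positivity) fun d hd hsum => ?_
    have hsub : {ω | ¬ t ≤ A.Te δ φ₁ ω} ⊆ (⋃ τ ∈ Finset.Ico 1 t, (A.accurate δ φ₁ τ (d τ))ᶜ) ∪
        ⋃ i, {ω | δ / 2 ≤ |A.noiseSum δ (P.binding φ₁) i t ω|} := by
      intro ω hω
      by_cases hacc : ∀ τ ∈ Finset.Ico 1 t, ω ∈ A.accurate δ φ₁ τ (d τ)
      · exact Or.inr (Set.mem_iUnion.2
          (A.exists_noiseSum_ge hδ hrho htT hlong hd hsum hacc hω))
      · push Not at hacc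
        obtain ⟨τ, hτ, h⟩ := hacc
        exact Or.inl (Set.mem_biUnion (s := {τ | τ ∈ Finset.Ico 1 t}) hτ h)
    have h1 := measureReal_mono (μ := A.law) hsub
    have h2 := h1.trans (measureReal_union_le _ _)
    have h3 := (measureReal_biUnion_finset_le (μ := A.law) (Finset.Ico 1 t)
      fun τ => (A.accurate δ φ₁ τ (d τ))ᶜ).trans
        (Finset.sum_le_sum fun τ hτ => hfC τ (hmem hτ) _ (hd τ hτ))
    have h4 := (measureReal_iUnion_fintype_le (μ := A.law)
      fun i => {ω | δ / 2 ≤ |A.noiseSum δ (P.binding φ₁) i t ω|}).trans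
        (Finset.sum_le_sum fun i _ => A.measure_noiseSum_ge_le δ (P.binding φ₁) i hδ ht htT)
    rw [Finset.sum_const, Finset.card_univ, Fintype.card_fin, nsmul_eq_mul, ← he] at h4
    linarith
  · have h0 : 0 ≤ gC T fC t (δ / 2) := gC_nonneg fun τ hτ d hd =>
      measureReal_nonneg.trans (hfC τ (hmem hτ) d hd)
    -- Here `δ (T - t) < 1` and `δ < 1/2` keep the exponential above `1/2`, so three times it
    -- exceeds any probability. Bounding `δ` takes an actual resource, hence `0 < n`.
    have hδ1 : δ < 1 / 2 := by
      have := hrho ⟨0, hn⟩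
      have := (P.rho_mem ⟨0, hn⟩).2
      linarith
    have h1 : 1 - δ ^ 2 / 2 * ((T : ℝ) - t) ≤ e := by
      have := Real.add_one_le_exp (-(δ ^ 2 / 2) * ((T : ℝ) - t))
      linarith
    have h2 : δ ^ 2 / 2 * ((T : ℝ) - t) ≤ 1 / 2 := by
      have : δ * ((T : ℝ) - t) ≤ 1 := by linarith
      have h3 : 0 ≤ δ * ((T : ℝ) - t) := mul_nonneg hδ.le (by linarith)
      nlinarith
    have h3 : A.law.real {ω | ¬ t ≤ A.Te δ φ₁ ω} ≤ 1 := measureReal_le_one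
    have h4 : 0 ≤ n * e := by positivity
    linarith

end ReSolving

end CBwK

/-! ### Decomposition of the regret -/

namespace CBwK

theorem sum_Icc_eq_sum_indicator {Ω : Type*} {T : ℕ} {N : Ω → ℕ} (X : ℕ → Ω → ℝ) {ω : Ω}
    (hN : N ω ≤ T) :
    ∑ t ∈ Finset.Icc 1 (N ω), X t ω = ∑ t ∈ Finset.Icc 1 T, {ω | t ≤ N ω}.indicator (X t) ω := by
  symm
  rw [← Finset.sum_subset (Finset.Icc_subset_Icc_right hN)]
  · exact Finset.sum_congr rfl fun t ht =>
      Set.indicator_of_mem (by exact (Finset.mem_Icc.1 ht).2) _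
  · intro t ht ht'
    refine Set.indicator_of_notMem (fun h => ht' ?_) _
    exact Finset.mem_Icc.2 ⟨(Finset.mem_Icc.1 ht).1, h⟩

/-- Passing from `T` to `T + 1` maps the sum `x` to `exp (-a) * x + 1`, and the bound is the fixed
point of this map. -/
theorem sum_exp_neg_mul_le {a : ℝ} (ha : 0 < a) (T : ℕ) :
    ∑ t ∈ Finset.Icc 1 T, Real.exp (-a * ((T : ℝ) - t)) ≤ 1 / (1 - Real.exp (-a)) := by
  have hq : 0 < 1 - Real.exp (-a) := by
    have := Real.exp_lt_one_iff.2 (neg_lt_zero.2 ha)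
    linarith
  induction T with
  | zero => simpa using hq.le
  | succ T ih =>
    rw [Finset.sum_Icc_succ_top (by omega), sub_self, mul_zero, Real.exp_zero]
    have h : ∑ t ∈ Finset.Icc 1 T, Real.exp (-a * (((T + 1 : ℕ) : ℝ) - t)) =
        Real.exp (-a) * ∑ t ∈ Finset.Icc 1 T, Real.exp (-a * ((T : ℝ) - t)) := by
      rw [Finset.mul_sum]
      refine Finset.sum_congr rfl fun t _ => ?_
      rw [← Real.exp_add]
      congr 1
      push_cast
      ring
    rw [h]
    calc Real.exp (-a) * ∑ t ∈ Finset.Icc 1 T, Real.exp (-a * ((T : ℝ) - t)) + 1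
        ≤ Real.exp (-a) * (1 / (1 - Real.exp (-a))) + 1 := by gcongr
      _ = 1 / (1 - Real.exp (-a)) := by field_simp; ring

namespace ReSolving

variable {n : ℕ} {Θ Γ : Type*} [MeasurableSpace Θ] [MeasurableSpace Γ] {P : Problem n Θ Γ}
  {T : ℕ} {fb : Feedback} (A : ReSolving P T fb) (δ : ℝ) (φ₁ : Θ → ℝ)

/-- Given the previous rounds, the outcome of round `k` has the law of `play (A.control k ω)`. -/
theorem integral_indicator_outcome {G : Outcome Θ Γ → ℝ} (hG : Measurable G) {a b : ℝ}
    (hGab : ∀ x, G x ∈ Set.Icc a b) {k : ℕ} (hk : 1 ≤ k) :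
    Integrable ({ω | k ≤ A.Te δ φ₁ ω}.indicator fun ω => G (A.outcome k ω)) A.law ∧
    ∫ ω, {ω | k ≤ A.Te δ φ₁ ω}.indicator (fun ω => G (A.outcome k ω)) ω ∂A.law =
      ∫ ω, {ω | k ≤ A.Te δ φ₁ ω}.indicator
        (fun ω => ∫ x, G (play (A.control k ω) x) ∂P.drawLaw) ω ∂A.law := by
  have hint : Integrable ({ω | k ≤ A.Te δ φ₁ ω}.indicator fun ω => G (A.outcome k ω)) A.law :=
    (Integrable.of_mem_Icc a b (hG.comp (A.measurable_outcome k)).aemeasurable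
      (Filter.Eventually.of_forall fun ω => hGab _)).indicator (A.measurableSet_le_Te δ φ₁ k)
  refine ⟨hint, ?_⟩
  rw [A.integral_eq_integral_update k hint]
  refine integral_congr_ae (Filter.Eventually.of_forall fun ω => ?_)
  -- Redrawing round `k` does not change whether `k ≤ Te`, so the indicator is constant in the inner
  -- integral.
  have hup := A.le_Te_update (δ := δ) (φ₁ := φ₁) hk ω
  dsimp only
  by_cases h : k ≤ A.Te δ φ₁ ω
  · rw [Set.indicator_of_mem (by exact h)]
    refine integral_congr_ae (Filter.Eventually.of_forall fun x => ?_)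
    dsimp only
    rw [Set.indicator_of_mem (by exact (hup x).2 h), A.outcome_update_self hk]
  · rw [Set.indicator_of_notMem (by exact h)]
    refine integral_eq_zero_of_ae (Filter.Eventually.of_forall fun x => ?_)
    exact Set.indicator_of_notMem (by exact mt (hup x).1 h) _

variable {δ φ₁}

/-- Complementary slackness replaces the priced consumption of `φ₁` by `λ·ρ`, which makes the error
the conditional mean of `roundLoss`. -/
theorem lagrangianError_eq {lam : Fin n → ℝ} (hφ : P.IsOptimal P.rho φ₁)
    (hlam : P.StrongDualityAt lam) {t : ℕ} (ht : 1 ≤ t) {ω : ℕ → Draw Θ Γ} (h : t ≤ A.T0 ω) :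
    A.lagrangianError φ₁ lam t ω = P.J P.rho - ∑ i, lam i * P.rho i -
      (P.ctrlReward (A.control t ω) - ∑ i, lam i * P.ctrlConsumption (A.control t ω) i) := by
  have h1 := P.integral_mul_lagrangian hφ.1.1 lam
  have h2 := P.integral_mul_lagrangian (A.isControl_of_le_T0 ht h) lam
  simp only [lagrangianError, sub_mul]
  rw [integral_sub h1.1 h2.1, h1.2, h2.2, hφ.J_eq,
    Finset.sum_congr rfl fun i _ => hlam.complementary hφ i]

/-- The loss of a round with outcome `x` against the Lagrangian optimum. -/
def roundLoss (P : Problem n Θ Γ) (lam : Fin n → ℝ) (x : Outcome Θ Γ) : ℝ :=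
  P.J P.rho - ∑ i, lam i * P.rho i -
    (P.r x.1 x.2.1 x.2.2 - ∑ i, lam i * P.c x.1 x.2.1 x.2.2 i)

theorem measurable_roundLoss (lam : Fin n → ℝ) : Measurable (roundLoss P lam) :=
  measurable_const.sub ((measurable_outcome_apply P.measurable_r).sub
    (Finset.measurable_fun_sum _ fun i _ => (measurable_consumption_apply i).const_mul _))

theorem roundLoss_mem {lam : Fin n → ℝ} (hlam : ∀ i, 0 ≤ lam i) (x : Outcome Θ Γ) :
    roundLoss P lam x ∈ Set.Icc (P.J P.rho - ∑ i, lam i * P.rho i - 1)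
      (P.J P.rho - ∑ i, lam i * P.rho i + ∑ i, lam i) := by
  have hr := P.r_mem x.1 x.2.1 x.2.2
  have h0 : 0 ≤ ∑ i, lam i * P.c x.1 x.2.1 x.2.2 i :=
    Finset.sum_nonneg fun i _ => mul_nonneg (hlam i) (P.c_mem _ _ _ i).1
  have h1 : ∑ i, lam i * P.c x.1 x.2.1 x.2.2 i ≤ ∑ i, lam i :=
    Finset.sum_le_sum fun i _ => mul_le_of_le_one_right (hlam i) (P.c_mem _ _ _ i).2
  constructor <;> unfold roundLoss <;> linarith [hr.1, hr.2]

theorem integral_roundLoss_play {lam : Fin n → ℝ} (hφ : P.IsOptimal P.rho φ₁)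
    (hlam : P.StrongDualityAt lam) {t : ℕ} (ht : 1 ≤ t) {ω : ℕ → Draw Θ Γ} (h : t ≤ A.T0 ω) :
    ∫ x, roundLoss P lam (play (A.control t ω) x) ∂P.drawLaw = A.lagrangianError φ₁ lam t ω := by
  have hc := A.isControl_of_le_T0 ht h
  have hm : Measurable fun x => play (A.control t ω) x :=
    (A.measurable_play_control t).comp measurable_prodMk_left
  have hr : Integrable (fun x => P.r (play (A.control t ω) x).1 (play (A.control t ω) x).2.1
      (play (A.control t ω) x).2.2) P.drawLaw :=
    Integrable.of_mem_Icc 0 1 ((measurable_outcome_apply P.measurable_r).comp hm).aemeasurable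
      (Filter.Eventually.of_forall fun _ => P.r_mem _ _ _)
  have hcc (i : Fin n) : Integrable (fun x => lam i * P.c (play (A.control t ω) x).1
      (play (A.control t ω) x).2.1 (play (A.control t ω) x).2.2 i) P.drawLaw :=
    (Integrable.of_mem_Icc 0 1 ((measurable_consumption_apply (P := P) i).comp hm).aemeasurable
      (Filter.Eventually.of_forall fun _ => P.c_mem _ _ _ _)).const_mul _
  have hs := integrable_finsetSum Finset.univ fun i _ => hcc i
  simp only [roundLoss]
  rw [integral_sub (integrable_const _) (by exact hr.sub hs), integral_sub hr hs,
    integral_finsetSum _ fun i _ => hcc i, A.lagrangianError_eq hφ hlam ht h]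
  simp only [integral_const_mul, P.integral_reward_play hc, P.integral_consumption_play hc,
    integral_const, probReal_univ, one_smul]

theorem integral_sum_lagrangianError {lam : Fin n → ℝ} (hφ : P.IsOptimal P.rho φ₁)
    (hlam : P.StrongDualityAt lam) :
    Integrable (fun ω => ∑ t ∈ Finset.Icc 1 (A.Te δ φ₁ ω), roundLoss P lam (A.outcome t ω))
      A.law ∧
    ∫ ω, ∑ t ∈ Finset.Icc 1 (A.Te δ φ₁ ω), A.lagrangianError φ₁ lam t ω ∂A.law =
      ∫ ω, ∑ t ∈ Finset.Icc 1 (A.Te δ φ₁ ω), roundLoss P lam (A.outcome t ω) ∂A.law := by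
  have key (t : ℕ) (ht : t ∈ Finset.Icc 1 T) := A.integral_indicator_outcome δ φ₁
    (measurable_roundLoss (P := P) lam) (roundLoss_mem hlam.1) (Finset.mem_Icc.1 ht).1
  have hsum (ω : ℕ → Draw Θ Γ) := sum_Icc_eq_sum_indicator
    (fun t ω => roundLoss P lam (A.outcome t ω)) (A.Te_le δ φ₁ ω)
  have hlag (ω : ℕ → Draw Θ Γ) : ∑ t ∈ Finset.Icc 1 (A.Te δ φ₁ ω), A.lagrangianError φ₁ lam t ω =
      ∑ t ∈ Finset.Icc 1 T, {ω | t ≤ A.Te δ φ₁ ω}.indicator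
        (fun ω => ∫ x, roundLoss P lam (play (A.control t ω) x) ∂P.drawLaw) ω := by
    rw [← sum_Icc_eq_sum_indicator (N := A.Te δ φ₁) _ (A.Te_le δ φ₁ ω)]
    refine Finset.sum_congr rfl fun t ht => ?_
    have ht := Finset.mem_Icc.1 ht
    exact (A.integral_roundLoss_play hφ hlam ht.1 (ht.2.trans (A.Te_le_T0 δ φ₁ ω))).symm
  simp only [hsum, hlag]
  refine ⟨integrable_finsetSum _ fun t ht => (key t ht).1, ?_⟩
  rw [integral_finsetSum _ fun t ht => (key t ht).1]
  have hint (t : ℕ) : Integrable ({ω | t ≤ A.Te δ φ₁ ω}.indicator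
      (fun ω => ∫ x, roundLoss P lam (play (A.control t ω) x) ∂P.drawLaw)) A.law := by
    have hm : Measurable fun p : (ℕ → Draw Θ Γ) × Draw Θ Γ =>
        roundLoss P lam (play (A.control t p.1) p.2) :=
      (measurable_roundLoss lam).comp (A.measurable_play_control t)
    refine (Integrable.integral_prod_left (Integrable.of_mem_Icc _ _ hm.aemeasurable
      (Filter.Eventually.of_forall fun p => roundLoss_mem hlam.1 _))).indicator
        (A.measurableSet_le_Te δ φ₁ t)
  rw [integral_finsetSum _ fun t _ => hint t]
  exact Finset.sum_congr rfl fun t ht => (key t ht).2.symm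

theorem integrable_sum_reward {N : (ℕ → Draw Θ Γ) → ℕ} (hN : ∀ ω, N ω ≤ T)
    (hNm : ∀ t, MeasurableSet {ω | t ≤ N ω}) :
    Integrable (fun ω => ∑ t ∈ Finset.Icc 1 (N ω), A.reward t ω) A.law := by
  simp only [fun ω => sum_Icc_eq_sum_indicator A.reward (hN ω)]
  exact integrable_finsetSum _ fun t _ => (Integrable.of_mem_Icc 0 1
    (A.measurable_reward t).aemeasurable
    (Filter.Eventually.of_forall fun ω => P.r_mem _ _ _)).indicator (hNm t)

theorem Te_eq_of_isEmpty [IsEmpty (Fin n)] (ω : ℕ → Draw Θ Γ) : A.Te δ φ₁ ω = T := by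
  refine le_antisymm (A.Te_le δ φ₁ ω) (A.le_Te_iff.2 ⟨A.le_T0_iff.2 ⟨le_rfl, ?_⟩, ?_⟩)
  · exact fun _ _ _ i => isEmptyElim i
  · exact fun _ _ _ => ⟨fun i => isEmptyElim i, fun i => isEmptyElim i, fun i => isEmptyElim i⟩

/-- Unused budget costs only at positive price, hence only for a binding resource, where membership
in the neighbourhood caps it; `λ i * δ ≤ 1/2` then makes the cost independent of the size of the
prices. -/
theorem lam_mul_leftover_le {lam : Fin n → ℝ} (hδ : 0 < δ) (hrho : ∀ i, δ < P.rho i / 2)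
    (hφ : P.IsOptimal P.rho φ₁) (hlam : P.StrongDualityAt lam) (ω : ℕ → Draw Θ Γ) (i : Fin n) :
    lam i * (A.B (A.Te δ φ₁ ω + 1) ω i - P.rho i * ((T : ℝ) - A.Te δ φ₁ ω)) ≤
      ((T : ℝ) - A.Te δ φ₁ ω) / 2 + 1 / δ := by
  have hle := A.Te_le δ φ₁ ω
  have hself : A.Te δ φ₁ ω ≤ A.Te δ φ₁ ω := le_rfl
  have hN := (A.le_Te_iff.1 hself).2
  generalize A.Te δ φ₁ ω = t at *
  have ht : 0 ≤ (T : ℝ) - t := sub_nonneg.2 (by exact_mod_cast hle)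
  have hrhs : 0 ≤ ((T : ℝ) - t) / 2 + 1 / δ := by positivity
  by_cases hi : i ∈ P.binding φ₁
  swap
  · rwa [hlam.eq_zero_of_not_binding hφ hi, zero_mul]
  rcases Nat.eq_zero_or_pos t with rfl | htpos
  · rw [A.B_one]
    simpa using hrhs
  have h1 := A.B_succ htpos ω i
  have h2 := (A.consumption_mem t ω i).1
  have h3 := A.rhoAt_mul htpos hle ω i
  have h4 := (abs_le.1 ((hN t htpos le_rfl).2.1 i hi)).2
  have h5 : A.rhoAt t ω i * ((T : ℝ) - t + 1) ≤ (P.rho i + δ) * ((T : ℝ) - t + 1) := by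
    gcongr
    linarith
  have h6 := (P.rho_mem i).2
  have h7 := hrho i
  -- The neighbourhood controls the budget before round `t = Te`, not after it; this extra round
  -- accounts for `ρ + δ ≤ 2`.
  have h8 : A.B (t + 1) ω i - P.rho i * ((T : ℝ) - t) ≤ δ * ((T : ℝ) - t) + 2 := by linarith
  have h9 : lam i * δ ≤ 1 / 2 := by
    have := hlam.lam_mul_rho_le hφ i
    nlinarith [hlam.1 i]
  have h10 : lam i ≤ 1 / 2 / δ := (le_div_iff₀ hδ).2 h9
  calc lam i * (A.B (t + 1) ω i - P.rho i * ((T : ℝ) - t))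
      ≤ lam i * (δ * ((T : ℝ) - t) + 2) := mul_le_mul_of_nonneg_left h8 (hlam.1 i)
    _ = lam i * δ * ((T : ℝ) - t) + lam i * 2 := by ring
    _ ≤ 1 / 2 * ((T : ℝ) - t) + 1 / 2 / δ * 2 := by gcongr
    _ = ((T : ℝ) - t) / 2 + 1 / δ := by ring

/-- In losses plus rewards the rewards cancel, leaving `N J(ρ)` and the priced consumption, which
the budget identity turns into leftover budget. -/
theorem fluid_le_sum_roundLoss {lam : Fin n → ℝ} (hδ : 0 < δ) (hrho : ∀ i, δ < P.rho i / 2)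
    (hφ : P.IsOptimal P.rho φ₁) (hlam : P.StrongDualityAt lam) (ω : ℕ → Draw Θ Γ) :
    P.fluid T ≤ ∑ t ∈ Finset.Icc 1 (A.Te δ φ₁ ω), roundLoss P lam (A.outcome t ω) +
      ∑ t ∈ Finset.Icc 1 (A.Te δ φ₁ ω), A.reward t ω +
        n * (3 / 2 * ((T : ℝ) - A.Te δ φ₁ ω) + 1 / δ) := by
  have hleft := Finset.sum_le_sum fun i (_ : i ∈ Finset.univ) =>
    A.lam_mul_leftover_le hδ hrho hφ hlam ω i
  rw [Finset.sum_const, Finset.card_univ, Fintype.card_fin, nsmul_eq_mul] at hleft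
  have hJn : ((T : ℝ) - A.Te δ φ₁ ω) * P.J P.rho ≤ n * ((T : ℝ) - A.Te δ φ₁ ω) := by
    have h0 : 0 ≤ (T : ℝ) - A.Te δ φ₁ ω := sub_nonneg.2 (by exact_mod_cast A.Te_le δ φ₁ ω)
    -- Absorbing `J(ρ) ≤ 1` into `n` needs a resource; without resources no round is lost.
    rcases Nat.eq_zero_or_pos n with rfl | hn
    · simp [A.Te_eq_of_isEmpty]
    · have : (1 : ℝ) ≤ n := by exact_mod_cast hn
      nlinarith [hφ.J_mem.2]
  have hB := A.B_eq (A.Te δ φ₁ ω) ω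
  generalize A.Te δ φ₁ ω = N at *
  have hsum : ∑ t ∈ Finset.Icc 1 N, roundLoss P lam (A.outcome t ω) +
      ∑ t ∈ Finset.Icc 1 N, A.reward t ω =
        N * P.J P.rho - ∑ i, lam i * (A.B (N + 1) ω i - P.rho i * ((T : ℝ) - N)) := by
    have h1 (i : Fin n) : lam i * (A.B (N + 1) ω i - P.rho i * ((T : ℝ) - N)) =
        N * (lam i * P.rho i) - ∑ t ∈ Finset.Icc 1 N, lam i * A.consumption t ω i := by
      rw [hB, ← Finset.mul_sum]
      ring
    simp only [h1]
    rw [Finset.sum_sub_distrib, ← Finset.mul_sum, Finset.sum_comm, ← Finset.sum_add_distrib]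
    have h2 (t : ℕ) : roundLoss P lam (A.outcome t ω) + A.reward t ω =
        P.J P.rho - ∑ i, lam i * P.rho i + ∑ i, lam i * A.consumption t ω i := by
      simp only [roundLoss, reward, consumption]
      ring
    simp only [h2]
    rw [Finset.sum_add_distrib, Finset.sum_const, Nat.card_Icc, nsmul_eq_mul]
    push_cast
    ring
  rw [hsum, Problem.fluid]
  linarith

theorem integral_sub_Te :
    Integrable (fun ω => (T : ℝ) - A.Te δ φ₁ ω) A.law ∧
    ∫ ω, ((T : ℝ) - A.Te δ φ₁ ω) ∂A.law =
      ∑ t ∈ Finset.Icc 1 T, A.law.real {ω | ¬ t ≤ A.Te δ φ₁ ω} := by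
  have h (ω : ℕ → Draw Θ Γ) : (T : ℝ) - A.Te δ φ₁ ω =
      ∑ t ∈ Finset.Icc 1 T, {ω | ¬ t ≤ A.Te δ φ₁ ω}.indicator (1 : (ℕ → Draw Θ Γ) → ℝ) ω := by
    have h1 := sum_Icc_eq_sum_indicator (N := A.Te δ φ₁) (fun _ _ => (1 : ℝ)) (A.Te_le δ φ₁ ω)
    have h2 : ∑ t ∈ Finset.Icc 1 T, (1 : ℝ) = T := by simp
    rw [Finset.sum_const, Nat.card_Icc, Nat.add_sub_cancel, nsmul_eq_mul, mul_one] at h1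
    rw [h1]
    nth_rewrite 1 [← h2]
    rw [← Finset.sum_sub_distrib]
    refine Finset.sum_congr rfl fun t _ => ?_
    by_cases ht : t ≤ A.Te δ φ₁ ω
    · rw [Set.indicator_of_mem (by exact ht), Set.indicator_of_notMem (by exact not_not.2 ht),
        sub_self]
    · rw [Set.indicator_of_notMem (by exact ht), Set.indicator_of_mem (by exact ht), sub_zero,
        Pi.one_apply]
  have hm (t : ℕ) : MeasurableSet {ω | ¬ t ≤ A.Te δ φ₁ ω} := (A.measurableSet_le_Te δ φ₁ t).compl
  have hi (t : ℕ) : Integrable ({ω | ¬ t ≤ A.Te δ φ₁ ω}.indicator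
      (1 : (ℕ → Draw Θ Γ) → ℝ)) A.law := (integrable_const (1 : ℝ)).indicator (hm t)
  simp only [h]
  refine ⟨integrable_finsetSum _ fun t _ => hi t, ?_⟩
  rw [integral_finsetSum _ fun t _ => hi t]
  exact Finset.sum_congr rfl fun t _ => integral_indicator_one (hm t)

/-- The regret is at most the Lagrangian estimation error and a multiple of the expected number
of rounds lost after `T_e`. -/
theorem regret_le {lam : Fin n → ℝ} (hδ : 0 < δ) (hrho : ∀ i, δ < P.rho i / 2)
    (hφ : P.IsOptimal P.rho φ₁) (hlam : P.StrongDualityAt lam) :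
    P.fluid T - A.rew ≤
      n * (3 / 2 * ∑ t ∈ Finset.Icc 1 T, A.law.real {ω | ¬ t ≤ A.Te δ φ₁ ω} + 1 / δ) +
        ∫ ω, ∑ t ∈ Finset.Icc 1 (A.Te δ φ₁ ω), A.lagrangianError φ₁ lam t ω ∂A.law := by
  have hL := A.integral_sum_lagrangianError (δ := δ) hφ hlam
  have hTe := A.integral_sub_Te (δ := δ) (φ₁ := φ₁)
  have hR0 := A.integrable_sum_reward A.T0_le A.measurableSet_le_T0
  have hR := A.integrable_sum_reward (A.Te_le δ φ₁) (A.measurableSet_le_Te δ φ₁)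
  -- Rewards earned between `Te` and `T0` are nonnegative and are given away.
  have hrew : ∫ ω, ∑ t ∈ Finset.Icc 1 (A.Te δ φ₁ ω), A.reward t ω ∂A.law ≤ A.rew :=
    integral_mono hR hR0 fun ω => Finset.sum_le_sum_of_subset_of_nonneg
      (Finset.Icc_subset_Icc_right (A.Te_le_T0 δ φ₁ ω)) fun t _ _ => (P.r_mem _ _ _).1
  have hlost : Integrable (fun ω => n * (3 / 2 * ((T : ℝ) - A.Te δ φ₁ ω) + 1 / δ)) A.law :=
    ((hTe.1.const_mul _).add (integrable_const _)).const_mul _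
  have h := integral_mono (μ := A.law) (integrable_const (P.fluid T)) ((hL.1.add hR).add hlost)
    fun ω => A.fluid_le_sum_roundLoss hδ hrho hφ hlam ω
  simp only [Pi.add_apply] at h
  rw [integral_add (by exact hL.1.add hR) hlost, integral_add hL.1 hR, ← hL.2, integral_const_mul,
    integral_add (hTe.1.const_mul _) (integrable_const _), integral_const_mul, hTe.2] at h
  simp only [integral_const, probReal_univ, one_smul] at h
  linarith

end ReSolving

end CBwK

end

/-! ### Assembly of the constants -/

theorem mainTheorem6 (δ : ℝ) (hδ : 0 < δ) :
    ∃ C₁ C₂ C₃ : ℝ, 0 < C₁ ∧ 0 < C₂ ∧ 0 < C₃ ∧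
      ∀ (n : ℕ) (Θ Γ : Type*) [MeasurableSpace Θ] [MeasurableSpace Γ]
        (P : CBwK.Problem n Θ Γ) (_ : ∀ i, δ < P.rho i / 2)
        (φ₁ : Θ → ℝ) (_ : P.IsOptimal P.rho φ₁)
        (lam : Fin n → ℝ) (_ : P.StrongDualityAt lam)
        (T : ℕ) (fb : CBwK.Feedback) (A : CBwK.ReSolving P T fb)
        (fC : ℕ → ℝ → ℝ)
        (_ : ∀ t ∈ Finset.Icc 1 (T - 1), ∀ d ∈ Set.Icc (0 : ℝ) 1,
          A.law.real (A.accurate δ φ₁ t d)ᶜ ≤ fC t d)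
        (fL : ℕ → ℝ)
        (_ : ∫ ω, ∑ t ∈ Finset.Icc 1 (A.Te δ φ₁ ω), A.lagrangianError φ₁ lam t ω ∂A.law ≤ fL T),
        P.fluid T - A.rew
          ≤ C₁ * n * (∑ t ∈ Finset.Icc 1 T, CBwK.gC T fC t (δ / 2) + C₂ * n + C₃) + fL T := by
  have hδ2 : 0 < δ ^ 2 / 2 := by positivity
  have hK : 0 < 1 / (1 - Real.exp (-(δ ^ 2 / 2))) := by
    have := Real.exp_lt_one_iff.2 (neg_lt_zero.2 hδ2)
    exact one_div_pos.2 (by linarith)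
  -- With `K` the geometric bound on the sum of the exponentials, `(2n + 3) K` splits into `C₂ n`
  -- and the first part of `C₃`. The `1/δ` in `C₃` is the leftover budget, enlarged by the factor
  -- `3/2` so that `C₁` factors out.
  refine ⟨3 / 2, 2 * (1 / (1 - Real.exp (-(δ ^ 2 / 2)))),
    3 * (1 / (1 - Real.exp (-(δ ^ 2 / 2)))) + 1 / δ, by norm_num, by positivity, by positivity, ?_⟩
  intro n Θ Γ _ _ P hrho φ₁ hφ lam hlam T fb A fC hfC fL hfL
  have hexp := CBwK.sum_exp_neg_mul_le hδ2 T
  set K := 1 / (1 - Real.exp (-(δ ^ 2 / 2)))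
  have hreg := A.regret_le hδ hrho hφ hlam
  -- Without resources the prefactor `n` already leaves only the Lagrangian error.
  rcases Nat.eq_zero_or_pos n with rfl | hn
  · simp only [Nat.cast_zero, zero_mul, mul_zero, zero_add] at hreg ⊢
    linarith
  have hprob := Finset.sum_le_sum fun t (ht : t ∈ Finset.Icc 1 T) =>
    A.measure_not_le_Te_le hn hδ hrho hfC (Finset.mem_Icc.1 ht).1 (Finset.mem_Icc.1 ht).2
  rw [Finset.sum_add_distrib, ← Finset.mul_sum] at hprob
  have hprob' := hprob.trans (add_le_add_right
    (mul_le_mul_of_nonneg_left hexp (by positivity : (0 : ℝ) ≤ 2 * n + 3)) _)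
  have hn0 : (0 : ℝ) ≤ n := by positivity
  have hδi : 0 < 1 / δ := by positivity
  calc P.fluid T - A.rew
      ≤ n * (3 / 2 * ∑ t ∈ Finset.Icc 1 T, A.law.real {ω | ¬ t ≤ A.Te δ φ₁ ω} + 1 / δ) + fL T := by
        linarith
    _ ≤ n * (3 / 2 * (∑ t ∈ Finset.Icc 1 T, CBwK.gC T fC t (δ / 2) + (2 * n + 3) * K) +
          3 / 2 * (1 / δ)) + fL T := by
        gcongr
        linarith
    _ = _ := by ring
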